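/- **Conventions.** Let $n,r$ be positive integers. Let $\mathcal C$ be the set of $GL(n,\mathbb C)$-orbits of quadruples $(X,Y;v,w)$ of complex matrices, of sizes $n\times n$, $n\times n$, $n\times r$, $r\times n$, such that $[X,Y]+vw=-I$; here $g$ acts by $(gXg^{-1},gYg^{-1};gv,wg^{-1})$. Let $\mathcal C^d\subset\mathcal C$ be the subset where $Y$ has $n$ distinct eigenvalues. Every point of $\mathcal C^d$ has a representative with $Y=\mathrm{diag}(\lambda_1,\dots,\lambda_n)$, $\lambda_i$ distinct; let $v_i$ be the rows of $v$, $w_i$ the columns of $w$ (so $v_iw_i=-1$), and $\alpha_i=X_{ii}$. Let $\Gamma$ be the group of entire maps $\gamma:\mathbb C\to GL_r(\mathbb C)$. It acts on $\mathcal C^d$ on the right: on a representative with $Y$ diagonal, $(X,Y;v,w)\circ\gamma$ is given by $$v_i\mapsto v_i\gamma(\lambda_i),\qquad w_j\mapsto\gamma(\lambda_j)^{-1}w_j,\qquad Y\mapsto Y,$$ $$X_{ii}\mapsto X_{ii}+v_i\gamma'(\lambda_i)\gamma(\lambda_i)^{-1}w_i,\qquad X_{ij}\mapsto\frac{v_i\gamma(\lambda_i)\gamma(\lambda_j)^{-1}w_j}{\lambda_i-\lambda_j}\quad(i\ne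 j).$$ A linear subspace $W\subseteq\mathbb C(z)^r$ (row vectors) is *fat* if $p\,\mathbb C[z]^r\subseteq W\subseteq q^{-1}\mathbb C[z]^r$ for some nonzero polynomials $p,q$. The set $\mathrm{Gr}^{rat}$ consists of the $W$ for which $p,q$ can be chosen so that moreover $W$ has codimension $r\deg q$ in $q^{-1}\mathbb C[z]^r$. Let $O_a$ be the ring of rational functions regular at $a\in\mathbb C$. A space $W$ is *primary decomposable* if $W=\bigcap_{a\in\mathbb C}U_a$ for some subspaces $(z-a)^NO_a^r\subseteq U_a\subseteq(z-a)^{-N}O_a^r$, with $N$ independent of $a$, and $U_a=O_a^r$ for all but finitely many $a$. The set $\mathrm{Gr}^{ad}$ consists of the fat primary decomposable $W$ such that the leading coefficients of all operators $D\in\mathbb C(z)[\partial_z]^r$ with $D.\mathbb C[z]\subseteq W$ form (together with $0$) the space $\mathbb C[z]^r$. For $\gamma\in\Gamma$, let $W\gamma$ be the space of the $f\in\mathbb C(z)^r$ that lie, for all sufficiently large $R$, in the $L^2$-closure of $\{g\gamma:g\in W\}$ on the circle $|z|=R$ (equivalently, in $\overline W\gamma$, where $\overline W$ is the $L^2$-closure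 of $W$ on that circle). **Proposition.** Send the class of $(X,Y;v,w)$, with $Y=\mathrm{diag}(\lambda_1,\dots,\lambda_n)$ as above, to the space $W$ of all $f\in\mathbb C(z)^r$ such that 1. $f$ is regular except at the points $\lambda_i$ and at $\infty$; 2. $f$ has at most a simple pole at each $\lambda_i$; 3. if $f=\sum_{k\ge-1}f^{(i)}_k(z-\lambda_i)^k$ near $\lambda_i$, then $f^{(i)}_{-1}$ is a scalar multiple of $v_i$ and $(f^{(i)}_0+\alpha_if^{(i)}_{-1})w_i=0$. This gives a well-defined map $\beta:\mathcal C^d\to\mathrm{Gr}^{ad}$, with values also in $\mathrm{Gr}^{rat}$, and $\beta$ is $\Gamma$-equivariant: $\beta(c\circ\gamma)=\beta(c)\,\gamma$ for all $c\in\mathcal C^d$ and $\gamma\in\Gamma$. -/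

import Mathlib

open Matrix

namespace VectorCM

noncomputable section

/-! ### Calogero-Moser spaces -/

/-- Quadruples `(X, Y; v, w)`: `X, Y` are `n × n`, `v` is `n × r` and `w` is `r × n`. -/
@[ext]
structure Quad (n r : ℕ) where
  X : Matrix (Fin n) (Fin n) ℂ
  Y : Matrix (Fin n) (Fin n) ℂ
  v : Matrix (Fin n) (Fin r) ℂ
  w : Matrix (Fin r) (Fin n) ℂ

variable {n r : ℕ}

/-- `GL(n, ℂ)` acts by `g (X, Y; v, w) = (g X g⁻¹, g Y g⁻¹; g v, w g⁻¹)`. -/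
instance : MulAction (GL (Fin n) ℂ) (Quad n r) where
  smul g q :=
    { X := (g : Matrix (Fin n) (Fin n) ℂ) * q.X * ((g⁻¹ : GL (Fin n) ℂ) : Matrix (Fin n) (Fin n) ℂ)
      Y := (g : Matrix (Fin n) (Fin n) ℂ) * q.Y * ((g⁻¹ : GL (Fin n) ℂ) : Matrix (Fin n) (Fin n) ℂ)
      v := (g : Matrix (Fin n) (Fin n) ℂ) * q.v
      w := q.w * ((g⁻¹ : GL (Fin n) ℂ) : Matrix (Fin n) (Fin n) ℂ) }
  one_smul q := by
    change Quad.mk _ _ _ _ = q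
    ext1 <;> simp
  mul_smul g h q := by
    change Quad.mk _ _ _ _ = Quad.mk (_ * (_ * _ * _) * _) (_ * (_ * _ * _) * _) (_ * (_ * _))
      (_ * _ * _)
    rw [_root_.mul_inv_rev, Units.val_mul, Units.val_mul]
    simp only [Matrix.mul_assoc]

theorem smul_X (g : GL (Fin n) ℂ) (q : Quad n r) : (g • q).X =
    (g : Matrix (Fin n) (Fin n) ℂ) * q.X * ((g⁻¹ : GL (Fin n) ℂ) : Matrix (Fin n) (Fin n) ℂ) := rfl

theorem smul_Y (g : GL (Fin n) ℂ) (q : Quad n r) : (g • q).Y =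
    (g : Matrix (Fin n) (Fin n) ℂ) * q.Y * ((g⁻¹ : GL (Fin n) ℂ) : Matrix (Fin n) (Fin n) ℂ) := rfl

theorem smul_v (g : GL (Fin n) ℂ) (q : Quad n r) : (g • q).v =
    (g : Matrix (Fin n) (Fin n) ℂ) * q.v := rfl

theorem smul_w (g : GL (Fin n) ℂ) (q : Quad n r) : (g • q).w =
    q.w * ((g⁻¹ : GL (Fin n) ℂ) : Matrix (Fin n) (Fin n) ℂ) := rfl

/-- The moment map `[X, Y] + v w`. -/
def Quad.moment (q : Quad n r) : Matrix (Fin n) (Fin n) ℂ :=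
  q.X * q.Y - q.Y * q.X + q.v * q.w

/-- The level set of the moment map at `-I`, with its `GL(n, ℂ)`-action. -/
def levelSet (n r : ℕ) : SubMulAction (GL (Fin n) ℂ) (Quad n r) where
  carrier := {q | q.moment = -1}
  smul_mem' g q hq := by
    have h1 : ((g⁻¹ : GL (Fin n) ℂ) : Matrix (Fin n) (Fin n) ℂ) * (g : Matrix (Fin n) (Fin n) ℂ)
        = 1 := by rw [← Units.val_mul]; simp
    have h2 : (g : Matrix (Fin n) (Fin n) ℂ) * ((g⁻¹ : GL (Fin n) ℂ) : Matrix (Fin n) (Fin n) ℂ)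
        = 1 := by rw [← Units.val_mul]; simp
    have key : (g • q).moment = (g : Matrix (Fin n) (Fin n) ℂ) * q.moment *
        ((g⁻¹ : GL (Fin n) ℂ) : Matrix (Fin n) (Fin n) ℂ) := by
      simp only [Quad.moment, smul_X, smul_Y, smul_v, smul_w]
      generalize ((g⁻¹ : GL (Fin n) ℂ) : Matrix (Fin n) (Fin n) ℂ) = k at *
      generalize (g : Matrix (Fin n) (Fin n) ℂ) = g at *
      have e : ∀ A B : Matrix (Fin n) (Fin n) ℂ, g * A * k * (g * B * k) = g * (A * B) * k := by
        intro A B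
        calc g * A * k * (g * B * k) = g * A * (k * g) * B * k := by simp only [Matrix.mul_assoc]
          _ = _ := by rw [h1]; simp only [Matrix.mul_assoc, Matrix.mul_one]
      have e' : g * q.v * (q.w * k) = g * (q.v * q.w) * k := by simp only [Matrix.mul_assoc]
      rw [e, e, e', Matrix.mul_add, Matrix.mul_sub, Matrix.add_mul, Matrix.sub_mul]
    change (g • q).moment = -1
    rw [key, show q.moment = -1 from hq]
    simp only [Matrix.mul_neg, Matrix.neg_mul, Matrix.mul_one, h2]

/-- The Calogero-Moser space: the quotient of the level set by `GL(n, ℂ)`. -/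
abbrev CMSpace (n r : ℕ) : Type := MulAction.orbitRel.Quotient (GL (Fin n) ℂ) (levelSet n r)

/-- The class in the Calogero-Moser space of a quadruple of the level set. -/
def CMSpace.mk (q : levelSet n r) : CMSpace n r := Quotient.mk _ q

/-- The part of the Calogero-Moser space where `Y` has `n` distinct eigenvalues. -/
def CMd (n r : ℕ) : Type :=
  {c : CMSpace n r // ∃ q : levelSet n r, CMSpace.mk q = c ∧ q.1.Y.charpoly.roots.Nodup}

/-- The quadruples of the level set with `Y` diagonal with distinct diagonal entries. -/
def DiagQuad (n r : ℕ) : Type :=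
  {q : levelSet n r // ∃ l : Fin n → ℂ, Function.Injective l ∧ q.1.Y = diagonal l}

/-- The class of a quadruple with `Y` diagonal with distinct entries. -/
def DiagQuad.toCMd (q : DiagQuad n r) : CMd n r :=
  ⟨CMSpace.mk q.1, q.1, rfl, by
    obtain ⟨l, hl, h⟩ := q.2
    rw [h, Matrix.charpoly_diagonal, Polynomial.roots_prod _ _
      (Finset.prod_ne_zero_iff.2 fun i _ => Polynomial.X_sub_C_ne_zero _)]
    simp only [Polynomial.roots_X_sub_C, Multiset.bind_singleton]
    exact (Multiset.nodup_map_iff_of_injective hl).2 Finset.univ.nodup⟩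

/-- A matrix with distinct eigenvalues is conjugate to a diagonal one. -/
theorem exists_conj_diagonal (A : Matrix (Fin n) (Fin n) ℂ) (h : A.charpoly.roots.Nodup) :
    ∃ (g : GL (Fin n) ℂ) (l : Fin n → ℂ), Function.Injective l ∧
      (g : Matrix (Fin n) (Fin n) ℂ) * A * ((g⁻¹ : GL (Fin n) ℂ) : Matrix (Fin n) (Fin n) ℂ)
        = diagonal l := by
  have hcard : A.charpoly.roots.card = n := by
    rw [IsAlgClosed.card_roots_eq_natDegree, Matrix.charpoly_natDegree_eq_dim, Fintype.card_fin]
  have hcard' : A.charpoly.roots.toFinset.card = n := by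
    rw [Multiset.toFinset_card_of_nodup h, hcard]
  let e := A.charpoly.roots.toFinset.equivFinOfCardEq hcard'
  let l : Fin n → ℂ := fun i => (e.symm i : ℂ)
  have hl : Function.Injective l := Subtype.val_injective.comp e.symm.injective
  have hev : ∀ i, ∃ x, Module.End.HasEigenvector (Matrix.toLin' A) (l i) x := by
    intro i
    have hr : A.charpoly.IsRoot (l i) :=
      Polynomial.isRoot_of_mem_roots (Multiset.mem_toFinset.1 (e.symm i).2)
    have : Module.End.HasEigenvalue (Matrix.toLin' A) (l i) := by
      rw [Module.End.hasEigenvalue_iff_isRoot_charpoly, Matrix.charpoly_toLin']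
      exact hr
    exact this.exists_hasEigenvector
  choose x hx using hev
  have hli := Module.End.eigenvectors_linearIndependent' (Matrix.toLin' A) l hl x hx
  let P : Matrix (Fin n) (Fin n) ℂ := Matrix.of fun i j => x j i
  have hP : IsUnit P := Matrix.linearIndependent_cols_iff_isUnit.1 (by exact hli)
  obtain ⟨u, hu⟩ := hP
  have hAP : A * P = P * diagonal l := by
    ext i j
    have := congrFun (hx j).apply_eq_smul i
    rw [Matrix.mul_diagonal]
    simp only [Matrix.toLin'_apply, Pi.smul_apply, smul_eq_mul] at this
    rw [mul_comm]
    exact this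
  refine ⟨u⁻¹, l, hl, ?_⟩
  rw [inv_inv, hu, Matrix.mul_assoc, hAP, ← Matrix.mul_assoc, ← hu, ← Units.val_mul]
  simp

/-- Every class in `CMd n r` has a representative with `Y` diagonal. -/
theorem CMd.exists_diag (c : CMd n r) : ∃ q : DiagQuad n r, q.toCMd = c := by
  obtain ⟨c, q, rfl, hq⟩ := c
  obtain ⟨g, l, hl, h⟩ := exists_conj_diagonal q.1.Y hq
  refine ⟨⟨g • q, l, hl, h⟩, ?_⟩
  apply Subtype.ext
  exact Quotient.sound ⟨g, rfl⟩

/-- A representative of a class in `CMd n r` with `Y` diagonal. -/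
def CMd.rep (c : CMd n r) : DiagQuad n r := c.exists_diag.choose

theorem CMd.rep_spec (c : CMd n r) : c.rep.toCMd = c := c.exists_diag.choose_spec

/-! ### The group of entire loops and its right action on `CMd` -/

/-- The group `Γ` of entire (holomorphic) maps from `ℂ` to `GL(r, ℂ)`. -/
def loopGroup (r : ℕ) : Subgroup (ℂ → GL (Fin r) ℂ) where
  carrier := {γ | ∀ i j, Differentiable ℂ fun z => (γ z : Matrix (Fin r) (Fin r) ℂ) i j}
  one_mem' i j := by simp
  mul_mem' {a b} ha hb i j := by
    simp only [Pi.mul_apply, Units.val_mul, Matrix.mul_apply]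
    exact Differentiable.fun_sum fun k _ => (ha i k).mul (hb k j)
  inv_mem' {a} ha i j := by
    have hdet : ∀ M : ℂ → Matrix (Fin r) (Fin r) ℂ, (∀ i j, Differentiable ℂ fun z => M z i j) →
        Differentiable ℂ fun z => (M z).det := by
      intro M hM
      simp only [Matrix.det_apply]
      exact Differentiable.fun_sum fun σ _ =>
        (Differentiable.fun_finsetProd fun k _ => hM _ _).const_smul _
    have h : ∀ z, ((a⁻¹ z : GL (Fin r) ℂ) : Matrix (Fin r) (Fin r) ℂ) i j =
        ((a z : Matrix (Fin r) (Fin r) ℂ).det)⁻¹ *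
          ((a z : Matrix (Fin r) (Fin r) ℂ).updateRow j (Pi.single i 1)).det := by
      intro z
      rw [Pi.inv_apply, Matrix.coe_units_inv, Matrix.inv_def, Matrix.smul_apply,
        Matrix.adjugate_apply, Ring.inverse_eq_inv', smul_eq_mul]
    simp only [h]
    refine Differentiable.mul (Differentiable.inv (hdet _ ha) fun z => ?_) (hdet _ ?_)
    · exact (Matrix.isUnits_det_units (a z)).ne_zero
    · intro k m
      by_cases hk : k = j
      · subst hk; simp
      · simpa [Matrix.updateRow_ne hk] using ha k m

/-- The type of entire loops. -/
abbrev Loop (r : ℕ) : Type := loopGroup r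

/-- The value `γ(z)`, as a matrix. -/
def Loop.mat (γ : Loop r) (z : ℂ) : Matrix (Fin r) (Fin r) ℂ := (γ.1 z : Matrix (Fin r) (Fin r) ℂ)

/-- The derivative `γ'(z)`. -/
def Loop.der (γ : Loop r) (z : ℂ) : Matrix (Fin r) (Fin r) ℂ :=
  Matrix.of fun i j => deriv (fun t => γ.mat t i j) z

/-- The formulae for `(X, Y; v, w) ∘ γ` when `Y = diag(λ₁, …, λₙ)` with distinct `λᵢ`:
`vᵢ ↦ vᵢ γ(λᵢ)`, `wⱼ ↦ γ(λⱼ)⁻¹ wⱼ`, `Xᵢᵢ ↦ Xᵢᵢ + vᵢ γ'(λᵢ) γ(λᵢ)⁻¹ wᵢ`,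
`Xᵢⱼ ↦ (v∘γ)ᵢ (w∘γ)ⱼ / (λᵢ - λⱼ)` for `i ≠ j`, and `Y ↦ Y`.
Here `vᵢ` is the `i`-th row of `v` and `wⱼ` the `j`-th column of `w`. -/
def Quad.loop (q : Quad n r) (γ : Loop r) : Quad n r where
  X := Matrix.of fun i j =>
    if i = j then
      q.X i i + q.v i ⬝ᵥ ((γ.der (q.Y i i) * (γ.mat (q.Y i i))⁻¹) *ᵥ q.wᵀ i)
    else
      (q.v i ᵥ* γ.mat (q.Y i i)) ⬝ᵥ ((γ.mat (q.Y j j))⁻¹ *ᵥ q.wᵀ j) / (q.Y i i - q.Y j j)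
  Y := q.Y
  v := Matrix.of fun i => q.v i ᵥ* γ.mat (q.Y i i)
  w := (Matrix.of fun j => (γ.mat (q.Y j j))⁻¹ *ᵥ q.wᵀ j)ᵀ

theorem Loop.isUnit_det (γ : Loop r) (z : ℂ) : IsUnit (γ.mat z).det :=
  Matrix.isUnits_det_units (γ.1 z)

theorem Loop.mat_mul (γ δ : Loop r) (z : ℂ) : (γ * δ).mat z = γ.mat z * δ.mat z := rfl

theorem Loop.mat_one (z : ℂ) : (1 : Loop r).mat z = 1 := rfl

theorem Loop.der_one (z : ℂ) : (1 : Loop r).der z = 0 := by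
  ext i j
  simp [Loop.der, Loop.mat_one]

theorem Loop.der_mul (γ δ : Loop r) (z : ℂ) :
    (γ * δ).der z = γ.der z * δ.mat z + γ.mat z * δ.der z := by
  ext i j
  have hγ : ∀ k, DifferentiableAt ℂ (fun t => γ.mat t i k) z := fun k => γ.2 i k z
  have hδ : ∀ k, DifferentiableAt ℂ (fun t => δ.mat t k j) z := fun k => δ.2 k j z
  simp only [Loop.der, Loop.mat_mul, Matrix.mul_apply, Matrix.add_apply, Matrix.of_apply]
  rw [deriv_fun_sum fun k _ => (hγ k).fun_mul (hδ k), ← Finset.sum_add_distrib]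
  exact Finset.sum_congr rfl fun k _ => deriv_fun_mul (hγ k) (hδ k)

theorem diag_relations (q : DiagQuad n r) (i j : Fin n) :
    q.1.1.X i j * (q.1.1.Y j j - q.1.1.Y i i) + q.1.1.v i ⬝ᵥ q.1.1.wᵀ j = if i = j then -1 else 0 := by
  obtain ⟨⟨q, hq⟩, l, hl, h⟩ := q
  have h0 : q.moment = -1 := hq
  have := congrFun (congrFun h0 i) j
  simp only at h
  simp only [Quad.moment, h, Matrix.add_apply, Matrix.sub_apply, Matrix.mul_diagonal,
    Matrix.diagonal_mul, Matrix.neg_apply, Matrix.one_apply] at this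
  simp only [h, Matrix.diagonal_apply_eq]
  have e : (q.v * q.w) i j = q.v i ⬝ᵥ q.wᵀ j := rfl
  rw [e] at this
  split_ifs at this ⊢ <;> linear_combination this

theorem diag_ne (q : DiagQuad n r) {i j : Fin n} (hij : i ≠ j) :
    q.1.1.Y i i - q.1.1.Y j j ≠ 0 := by
  obtain ⟨q, l, hl, h⟩ := q
  simp only [h, Matrix.diagonal_apply_eq]
  exact sub_ne_zero.2 (hl.ne hij)

theorem diag_vw (q : DiagQuad n r) (i : Fin n) : q.1.1.v i ⬝ᵥ q.1.1.wᵀ i = -1 := by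
  simpa using diag_relations q i i

theorem diag_X (q : DiagQuad n r) {i j : Fin n} (hij : i ≠ j) :
    q.1.1.X i j = q.1.1.v i ⬝ᵥ q.1.1.wᵀ j / (q.1.1.Y i i - q.1.1.Y j j) := by
  have := diag_relations q i j
  rw [if_neg hij] at this
  rw [eq_div_iff (diag_ne q hij)]
  linear_combination -this

/-- The quadruple `(X, Y; v, w) ∘ γ` lies again in the level set. -/
def DiagQuad.loop (q : DiagQuad n r) (γ : Loop r) : DiagQuad n r :=
  ⟨⟨q.1.1.loop γ, by
    change Quad.moment _ = -1
    obtain ⟨l, hl, h⟩ := q.2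
    have hY : (q.1.1.loop γ).Y = diagonal l := h
    have hl' : ∀ i, q.1.1.Y i i = l i := fun i => by rw [h, Matrix.diagonal_apply_eq]
    ext i j
    have e : ((q.1.1.loop γ).v * (q.1.1.loop γ).w) i j =
      (q.1.1.v i ᵥ* γ.mat (q.1.1.Y i i)) ⬝ᵥ ((γ.mat (q.1.1.Y j j))⁻¹ *ᵥ q.1.1.wᵀ j) := rfl
    simp only [Quad.moment, hY, Matrix.add_apply, Matrix.sub_apply, Matrix.mul_diagonal,
      Matrix.diagonal_mul, Matrix.neg_apply, Matrix.one_apply, e]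
    by_cases hij : i = j
    · subst hij
      rw [← Matrix.dotProduct_mulVec, Matrix.mulVec_mulVec,
        Matrix.mul_nonsing_inv _ (γ.isUnit_det _), Matrix.one_mulVec, diag_vw, if_pos rfl]
      ring
    · have hne : l i - l j ≠ 0 := sub_ne_zero.2 (hl.ne hij)
      simp only [Quad.loop, Matrix.of_apply, if_neg hij, hl']
      field_simp
      ring⟩, q.2⟩

/-- Two diagonal representatives of the same class. -/
theorem DiagQuad.exists_smul {q₁ q₂ : DiagQuad n r} (h : q₁.toCMd = q₂.toCMd) :
    ∃ g : GL (Fin n) ℂ, g • q₁.1.1 = q₂.1.1 := by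
  have h1 : CMSpace.mk q₁.1 = CMSpace.mk q₂.1 := congrArg Subtype.val h
  obtain ⟨g, hg⟩ := MulAction.orbitRel_apply.1 (Quotient.exact h1.symm)
  exact ⟨g, congrArg Subtype.val hg⟩

/-- The kernel `(γ(a) γ(b)⁻¹ - 1) / (a - b)`, extended to the diagonal. -/
def loopKernel (γ : Loop r) (a b : ℂ) : Matrix (Fin r) (Fin r) ℂ :=
  if a = b then γ.der a * (γ.mat a)⁻¹ else (a - b)⁻¹ • (γ.mat a * (γ.mat b)⁻¹ - 1)

theorem loop_X (q : DiagQuad n r) (γ : Loop r) (i j : Fin n) :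
    (q.1.1.loop γ).X i j = q.1.1.X i j +
      q.1.1.v i ⬝ᵥ (loopKernel γ (q.1.1.Y i i) (q.1.1.Y j j) *ᵥ q.1.1.wᵀ j) := by
  by_cases hij : i = j
  · subst hij
    simp [Quad.loop, loopKernel]
  · have hne := diag_ne q hij
    have hne' : q.1.1.Y i i ≠ q.1.1.Y j j := sub_ne_zero.1 hne
    rw [diag_X q hij, loopKernel, if_neg hne', Matrix.smul_mulVec, Matrix.sub_mulVec,
      Matrix.one_mulVec, dotProduct_smul, dotProduct_sub, ← Matrix.mulVec_mulVec,
      Matrix.dotProduct_mulVec, smul_eq_mul]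
    simp only [Quad.loop, Matrix.of_apply, if_neg hij]
    field_simp
    ring

theorem smul_intertwine {q₁ q₂ : DiagQuad n r} {g : GL (Fin n) ℂ} (h : g • q₁.1.1 = q₂.1.1)
    {i j : Fin n} (hg : (g : Matrix (Fin n) (Fin n) ℂ) i j ≠ 0) :
    q₁.1.1.Y j j = q₂.1.1.Y i i := by
  have hY : (g : Matrix (Fin n) (Fin n) ℂ) * q₁.1.1.Y = q₂.1.1.Y * g := by
    rw [← h, smul_Y, Matrix.mul_assoc _ _ (g : Matrix (Fin n) (Fin n) ℂ), ← Units.val_mul]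
    simp
  obtain ⟨l₁, -, h₁⟩ := q₁.2
  obtain ⟨l₂, -, h₂⟩ := q₂.2
  have := congrFun (congrFun hY i) j
  simp only [h₁, h₂, Matrix.mul_diagonal, Matrix.diagonal_mul] at this
  simp only [h₁, h₂, Matrix.diagonal_apply_eq]
  rw [mul_comm] at this
  exact mul_right_cancel₀ hg this

theorem smul_intertwine_inv {q₁ q₂ : DiagQuad n r} {g : GL (Fin n) ℂ} (h : g • q₁.1.1 = q₂.1.1)
    {i j : Fin n} (hg : ((g⁻¹ : GL (Fin n) ℂ) : Matrix (Fin n) (Fin n) ℂ) i j ≠ 0) :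
    q₁.1.1.Y i i = q₂.1.1.Y j j :=
  (smul_intertwine (q₁ := q₂) (q₂ := q₁) (by rw [← h, inv_smul_smul]) hg).symm

/-- The action of a loop does not depend on the choice of a diagonal representative. -/
theorem DiagQuad.loop_toCMd {q₁ q₂ : DiagQuad n r} (h : q₁.toCMd = q₂.toCMd) (γ : Loop r) :
    (q₁.loop γ).toCMd = (q₂.loop γ).toCMd := by
  obtain ⟨g, hg⟩ := DiagQuad.exists_smul h
  have hv : ∀ i, q₂.1.1.v i = ∑ k, (g : Matrix (Fin n) (Fin n) ℂ) i k • q₁.1.1.v k := by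
    intro i
    ext m
    rw [← hg, smul_v, Matrix.mul_apply]
    simp
  have hw : ∀ j, q₂.1.1.wᵀ j =
      ∑ k, ((g⁻¹ : GL (Fin n) ℂ) : Matrix (Fin n) (Fin n) ℂ) k j • q₁.1.1.wᵀ k := by
    intro j
    ext m
    rw [← hg, smul_w, Matrix.transpose_apply, Matrix.mul_apply]
    simp [mul_comm]
  have hX : q₂.1.1.X = (g : Matrix (Fin n) (Fin n) ℂ) * q₁.1.1.X *
      ((g⁻¹ : GL (Fin n) ℂ) : Matrix (Fin n) (Fin n) ℂ) := by rw [← hg, smul_X]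
  have key : g • q₁.1.1.loop γ = q₂.1.1.loop γ := by
    ext i j
    · rw [loop_X, smul_X, hX]
      have e1 : (q₁.1.1.loop γ).X = q₁.1.1.X + Matrix.of fun i j =>
          q₁.1.1.v i ⬝ᵥ (loopKernel γ (q₁.1.1.Y i i) (q₁.1.1.Y j j) *ᵥ q₁.1.1.wᵀ j) := by
        ext i j
        rw [loop_X, Matrix.add_apply, Matrix.of_apply]
      rw [e1, Matrix.mul_add, Matrix.add_mul, Matrix.add_apply]
      congr 1
      rw [hv, hw, Matrix.mulVec_sum, dotProduct_sum, Matrix.mul_apply]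
      refine Finset.sum_congr rfl fun k _ => ?_
      by_cases hk : ((g⁻¹ : GL (Fin n) ℂ) : Matrix (Fin n) (Fin n) ℂ) k j = 0
      · simp [hk]
      rw [Matrix.mulVec_smul, dotProduct_smul, smul_eq_mul, mul_comm, sum_dotProduct,
        Matrix.mul_apply]
      congr 1
      refine Finset.sum_congr rfl fun m _ => ?_
      by_cases hm : (g : Matrix (Fin n) (Fin n) ℂ) i m = 0
      · simp [hm]
      rw [smul_dotProduct, smul_eq_mul, Matrix.of_apply, smul_intertwine hg hm,
        smul_intertwine_inv hg hk]
    · exact congrFun (congrFun (congrArg Quad.Y hg) i) j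
    · have e2 : (q₂.1.1.loop γ).v i = q₂.1.1.v i ᵥ* γ.mat (q₂.1.1.Y i i) := rfl
      rw [e2, hv, smul_v, Matrix.mul_apply, Matrix.sum_vecMul, Finset.sum_apply]
      refine Finset.sum_congr rfl fun m _ => ?_
      by_cases hm : (g : Matrix (Fin n) (Fin n) ℂ) i m = 0
      · simp [hm]
      rw [Matrix.smul_vecMul, ← smul_intertwine hg hm]
      rfl
    · have e2 : (q₂.1.1.loop γ).w i j = ((γ.mat (q₂.1.1.Y j j))⁻¹ *ᵥ q₂.1.1.wᵀ j) i := rfl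
      rw [e2, hw, smul_w, Matrix.mul_apply, Matrix.mulVec_sum, Finset.sum_apply]
      refine Finset.sum_congr rfl fun m _ => ?_
      by_cases hm : ((g⁻¹ : GL (Fin n) ℂ) : Matrix (Fin n) (Fin n) ℂ) m j = 0
      · simp [hm]
      rw [Matrix.mulVec_smul, ← smul_intertwine_inv hg hm, mul_comm]
      rfl
  apply Subtype.ext
  exact (Quotient.sound (a := (q₂.loop γ).1) (b := (q₁.loop γ).1)
    (MulAction.orbitRel_apply.2 ⟨g, Subtype.ext key⟩)).symm

theorem loop_v_row (q : Quad n r) (γ : Loop r) (i : Fin n) :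
    (q.loop γ).v i = q.v i ᵥ* γ.mat (q.Y i i) := rfl

theorem loop_w_col (q : Quad n r) (γ : Loop r) (j : Fin n) :
    (q.loop γ).wᵀ j = (γ.mat (q.Y j j))⁻¹ *ᵥ q.wᵀ j := rfl

theorem loop_Y (q : Quad n r) (γ : Loop r) : (q.loop γ).Y = q.Y := rfl

theorem loop_X_diag (q : Quad n r) (γ : Loop r) (i : Fin n) : (q.loop γ).X i i =
    q.X i i + q.v i ⬝ᵥ ((γ.der (q.Y i i) * (γ.mat (q.Y i i))⁻¹) *ᵥ q.wᵀ i) := by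
  simp [Quad.loop]

theorem loop_X_offDiag (q : Quad n r) (γ : Loop r) {i j : Fin n} (hij : i ≠ j) :
    (q.loop γ).X i j = (q.loop γ).v i ⬝ᵥ (q.loop γ).wᵀ j / (q.Y i i - q.Y j j) := by
  rw [loop_v_row, loop_w_col]
  simp [Quad.loop, hij]

theorem DiagQuad.loop_one (q : DiagQuad n r) : q.loop 1 = q := by
  apply Subtype.ext
  apply Subtype.ext
  change q.1.1.loop 1 = q.1.1
  ext i j
  · rw [loop_X]
    have : loopKernel (1 : Loop r) (q.1.1.Y i i) (q.1.1.Y j j) = 0 := by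
      unfold loopKernel
      split_ifs <;> simp [Loop.der_one, Loop.mat_one]
    simp [this]
  · rfl
  · simp [Quad.loop, Loop.mat_one]
  · simp [Quad.loop, Loop.mat_one]

theorem DiagQuad.loop_mul (q : DiagQuad n r) (γ δ : Loop r) :
    q.loop (γ * δ) = (q.loop γ).loop δ := by
  apply Subtype.ext
  apply Subtype.ext
  change q.1.1.loop (γ * δ) = (q.1.1.loop γ).loop δ
  have hv : ∀ i, ((q.1.1.loop γ).loop δ).v i = (q.1.1.loop (γ * δ)).v i := by
    intro i
    simp only [loop_v_row, loop_Y, Loop.mat_mul, Matrix.vecMul_vecMul]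
  have hw : ∀ j, ((q.1.1.loop γ).loop δ).wᵀ j = (q.1.1.loop (γ * δ)).wᵀ j := by
    intro i
    simp only [loop_w_col, loop_Y, Loop.mat_mul, Matrix.mulVec_mulVec, Matrix.mul_inv_rev]
  ext i j
  · by_cases hij : i = j
    · subst hij
      have hd := Matrix.mul_nonsing_inv _ (δ.isUnit_det (q.1.1.Y i i))
      simp only [loop_X_diag, loop_v_row, loop_w_col, loop_Y, Loop.der_mul, Loop.mat_mul,
        Matrix.mul_inv_rev]
      rw [add_assoc, ← Matrix.dotProduct_mulVec, Matrix.mulVec_mulVec, Matrix.mulVec_mulVec,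
        ← dotProduct_add, ← Matrix.add_mulVec]
      congr 3
      generalize (δ.mat (q.1.1.Y i i)) = D at *
      generalize (γ.mat (q.1.1.Y i i)) = G at *
      rw [Matrix.add_mul]
      congr 1
      · calc γ.der (q.1.1.Y i i) * D * (D⁻¹ * G⁻¹)
            = γ.der (q.1.1.Y i i) * (D * D⁻¹) * G⁻¹ := by simp only [Matrix.mul_assoc]
          _ = _ := by rw [hd, Matrix.mul_one]
      · simp only [Matrix.mul_assoc]
    · rw [loop_X_offDiag _ _ hij, loop_X_offDiag _ _ hij, hv, hw, loop_Y]
  · rfl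
  · rw [hv]
  · exact (congrFun (hw j) i).symm

/-- The right action `c ∘ γ` of the group of entire loops on `CMd n r`, as a left action of the
opposite group. -/
instance : MulAction (Loop r)ᵐᵒᵖ (CMd n r) where
  smul γ c := (c.rep.loop γ.unop).toCMd
  one_smul c := by
    change (c.rep.loop 1).toCMd = c
    rw [DiagQuad.loop_one, c.rep_spec]
  mul_smul γ δ c := by
    change (c.rep.loop (δ.unop * γ.unop)).toCMd = (DiagQuad.loop (CMd.rep _) γ.unop).toCMd
    rw [DiagQuad.loop_mul]
    exact DiagQuad.loop_toCMd (CMd.rep_spec (c.rep.loop δ.unop).toCMd).symm _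

/-- The action of a loop is given by the formulae above on every diagonal representative. -/
theorem op_smul_toCMd (q : DiagQuad n r) (γ : Loop r) :
    MulOpposite.op γ • q.toCMd = (q.loop γ).toCMd :=
  DiagQuad.loop_toCMd (CMd.rep_spec _) γ

/-! ### Grassmannians -/

/-- Row vectors of `r` rational functions, the space `ℂ(z)^r`. -/
abbrev RatVec (r : ℕ) : Type := Fin r → RatFunc ℂ

open scoped RatFunc in
/-- The coefficient of `(z - a)^k` in the Laurent expansion of a rational function at `a`. -/
def laurentCoeff (a : ℂ) (k : ℤ) : RatFunc ℂ →ₗ[ℂ] ℂ where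
  toFun f := (algebraMap (RatFunc ℂ) (LaurentSeries ℂ) (RatFunc.laurent a f)).coeff k
  map_add' f g := by simp
  map_smul' c f := by
    rw [RatFunc.smul_eq_C_mul, map_mul, map_mul, RatFunc.laurent_C, ← RatFunc.algebraMap_C,
      ← IsScalarTower.algebraMap_apply (Polynomial ℂ) (RatFunc ℂ) (LaurentSeries ℂ)]
    have h : algebraMap (Polynomial ℂ) (LaurentSeries ℂ) (Polynomial.C c) = HahnSeries.C c := by
      simp [Polynomial.algebraMap_hahnSeries_apply]
    rw [h, HahnSeries.C_mul_eq_smul]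
    rfl

/-- The coefficient of `(z - a)^k` in the Laurent expansion of a vector at `a`. -/
def vecCoeff (a : ℂ) (k : ℤ) : RatVec r →ₗ[ℂ] (Fin r → ℂ) :=
  (laurentCoeff a k).compLeft (Fin r)

/-- The space `s(z) ℂ[z]^r`, for a rational function `s`. -/
def polyMultiples (r : ℕ) (s : RatFunc ℂ) : Submodule ℂ (RatVec r) where
  carrier := {f | ∃ h : Fin r → Polynomial ℂ, ∀ i, f i = s * algebraMap _ _ (h i)}
  add_mem' := by
    rintro f g ⟨h, hf⟩ ⟨k, hg⟩
    exact ⟨h + k, fun i => by simp [hf, hg, mul_add]⟩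
  zero_mem' := ⟨0, fun i => by simp⟩
  smul_mem' := by
    rintro c f ⟨h, hf⟩
    refine ⟨c • h, fun i => ?_⟩
    simp only [Pi.smul_apply, hf, Polynomial.smul_eq_C_mul, map_mul, RatFunc.algebraMap_C,
      RatFunc.smul_eq_C_mul]
    ring

/-- `W` is fat: `p ℂ[z]^r ⊆ W ⊆ q⁻¹ ℂ[z]^r` for some nonzero polynomials `p, q`. -/
def IsFat (W : Submodule ℂ (RatVec r)) : Prop :=
  ∃ p q : Polynomial ℂ, p ≠ 0 ∧ q ≠ 0 ∧ polyMultiples r (algebraMap _ _ p) ≤ W ∧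
    W ≤ polyMultiples r (algebraMap _ _ q)⁻¹

/-- The rational Grassmannian: `p ℂ[z]^r ⊆ W ⊆ q⁻¹ ℂ[z]^r` for some nonzero polynomials `p, q`
such that `W` has codimension `r deg q` in `q⁻¹ ℂ[z]^r`. -/
def ratGr (r : ℕ) : Set (Submodule ℂ (RatVec r)) :=
  {W | ∃ p q : Polynomial ℂ, p ≠ 0 ∧ q ≠ 0 ∧ polyMultiples r (algebraMap _ _ p) ≤ W ∧
    W ≤ polyMultiples r (algebraMap _ _ q)⁻¹ ∧
    Module.finrank ℂ (↥(polyMultiples r (algebraMap _ _ q)⁻¹) ⧸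
      W.comap (polyMultiples r (algebraMap _ _ q)⁻¹).subtype) = r * q.natDegree}

/-- The vectors all of whose entries have order at least `N` at `a`. -/
def orderGE (r : ℕ) (a : ℂ) (N : ℤ) : Submodule ℂ (RatVec r) :=
  ⨅ k : {k : ℤ // k < N}, LinearMap.ker (vecCoeff a k.1)

/-- `W` is primary decomposable: it is cut out by independent local conditions at finitely many
points, that is, `W` is the intersection over all points `a` of local spaces `U a` lying
between `(z - a)^N O_a^r` and `(z - a)^{-N} O_a^r`, where `O_a` is the ring of rational functions
that are regular at `a`, and `U a = O_a^r` for all but finitely many `a`. -/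
def IsPrimaryDecomposable (W : Submodule ℂ (RatVec r)) : Prop :=
  ∃ (S : Finset ℂ) (N : ℕ) (U : ℂ → Submodule ℂ (RatVec r)),
    (∀ a, orderGE r a N ≤ U a ∧ U a ≤ orderGE r a (-N)) ∧
    (∀ a ∉ S, U a = orderGE r a 0) ∧ W = ⨅ a, U a

/-- Differential operators `D = ∑ₖ aₖ ∂ᵏ` with coefficients `aₖ` in `ℂ(z)^r`, that is, the
elements of `ℂ(z)[∂]^r`. -/
abbrev DiffOp (r : ℕ) : Type := ℕ →₀ RatVec r

/-- The action `D.p = ∑ₖ aₖ p⁽ᵏ⁾` on polynomials. -/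
def DiffOp.apply (D : DiffOp r) (p : Polynomial ℂ) : RatVec r :=
  D.sum fun k a => algebraMap (Polynomial ℂ) (RatFunc ℂ) (Polynomial.derivative^[k] p) • a

/-- The set of operators `D` with `D.ℂ[z] ⊆ W`. -/
def opsInto (W : Submodule ℂ (RatVec r)) : Set (DiffOp r) := {D | ∀ p, D.apply p ∈ W}

/-- The space of leading coefficients of the operators `D` with `D.ℂ[z] ⊆ W` (with zero). -/
def leadingCoeffs (W : Submodule ℂ (RatVec r)) : Set (RatVec r) :=
  {a | ∃ D ∈ opsInto W, ∃ m, (∀ k, m < k → D k = 0) ∧ D m = a}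

/-- The adelic Grassmannian: the fat primary decomposable spaces `W` whose space of leading
coefficients is `ℂ[z]^r`. -/
def adelicGr (r : ℕ) : Set (Submodule ℂ (RatVec r)) :=
  {W | IsFat W ∧ IsPrimaryDecomposable W ∧
    leadingCoeffs W = {f | ∃ h : Fin r → Polynomial ℂ, ∀ i, f i = algebraMap _ _ (h i)}}

/-! ### The action of loops on subspaces of `ℂ(z)^r` -/

/-- The value of a vector of rational functions at a point (used away from the poles). -/
def RatVec.eval (f : RatVec r) (z : ℂ) : Fin r → ℂ := fun i => (f i).eval (RingHom.id ℂ) z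

/-- The norm of a vector-valued function in `L²` of the circle `|z| = R`, with values in `ℂ^r`
with its Hermitian norm. -/
def circleNorm (R : ℝ) (u : ℂ → Fin r → ℂ) : ENNReal :=
  MeasureTheory.eLpNorm (fun θ : ℝ => (WithLp.toLp 2 (u (circleMap 0 R θ)) :
    EuclideanSpace ℂ (Fin r))) 2 (MeasureTheory.volume.restrict (Set.Ioc 0 (2 * Real.pi)))

theorem measurable_eval (f : RatVec r) : Measurable (RatVec.eval f) := by
  refine measurable_pi_lambda _ fun i => ?_
  simp only [RatVec.eval, RatFunc.eval, Polynomial.eval₂_id]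
  exact (Polynomial.continuous _).measurable.div (Polynomial.continuous _).measurable

theorem measurable_eval_loop (f : RatVec r) (γ : Loop r) :
    Measurable fun z => RatVec.eval f z ᵥ* γ.mat z := by
  refine measurable_pi_lambda _ fun i => ?_
  simp only [Matrix.vecMul, dotProduct]
  refine Finset.measurable_sum _ fun k _ => ?_
  exact ((measurable_pi_apply k).comp (measurable_eval f)).mul (γ.2 k i).continuous.measurable

theorem circleNorm_add_le (R : ℝ) {u v : ℂ → Fin r → ℂ} (hu : Measurable u) (hv : Measurable v) :
    circleNorm R (u + v) ≤ circleNorm R u + circleNorm R v := by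
  have h : ∀ {u : ℂ → Fin r → ℂ}, Measurable u → MeasureTheory.AEStronglyMeasurable
      (fun θ : ℝ => (WithLp.toLp 2 (u (circleMap 0 R θ)) : EuclideanSpace ℂ (Fin r)))
      (MeasureTheory.volume.restrict (Set.Ioc 0 (2 * Real.pi))) := fun hu =>
    ((WithLp.measurable_toLp 2 _).comp
      (hu.comp (continuous_circleMap 0 R).measurable)).aestronglyMeasurable
  unfold circleNorm
  refine le_trans (le_of_eq ?_) (MeasureTheory.eLpNorm_add_le (h hu) (h hv) one_le_two)
  congr 1

theorem circleNorm_smul (R : ℝ) (c : ℂ) (u : ℂ → Fin r → ℂ) :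
    circleNorm R (c • u) = ‖c‖ₑ * circleNorm R u := by
  unfold circleNorm
  rw [← MeasureTheory.eLpNorm_const_smul]
  congr 1

theorem circleNorm_congr {R : ℝ} (hR : R ≠ 0) {u v : ℂ → Fin r → ℂ} (S : Set ℂ) (hS : S.Finite)
    (h : ∀ z ∉ S, u z = v z) : circleNorm R u = circleNorm R v := by
  refine MeasureTheory.eLpNorm_congr_ae (MeasureTheory.ae_restrict_of_ae ?_)
  have h0 := (hS.countable.preimage_circleMap 0 hR).measure_zero MeasureTheory.volume
  filter_upwards [MeasureTheory.measure_eq_zero_iff_ae_notMem.1 h0] with θ hθ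
  simp only [h _ hθ]

/-- The poles of a vector of rational functions. -/
def poles (f : RatVec r) : Set ℂ := {z | ∃ i, (f i).denom.eval z = 0}

theorem poles_finite (f : RatVec r) : (poles f).Finite := by
  have : poles f ⊆ ⋃ i, ((f i).denom.roots.toFinset : Set ℂ) := by
    rintro z ⟨i, hz⟩
    refine Set.mem_iUnion.2 ⟨i, ?_⟩
    simp only [Finset.mem_coe, Multiset.mem_toFinset]
    exact (Polynomial.mem_roots (RatFunc.denom_ne_zero _)).2 hz
  exact (Set.finite_iUnion fun i => Finset.finite_toSet _).subset this

theorem eval_add_of_notMem {f g : RatVec r} {z : ℂ} (hf : z ∉ poles f) (hg : z ∉ poles g) :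
    RatVec.eval (f + g) z = RatVec.eval f z + RatVec.eval g z := by
  ext i
  refine RatFunc.eval_add _ _ ?_ ?_
  · rw [Polynomial.eval₂_id]; exact fun h => hf ⟨i, h⟩
  · rw [Polynomial.eval₂_id]; exact fun h => hg ⟨i, h⟩

theorem eval_smul_of_notMem {f : RatVec r} {z : ℂ} (c : ℂ) (hf : z ∉ poles f) :
    RatVec.eval (c • f) z = c • RatVec.eval f z := by
  ext i
  simp only [RatVec.eval, Pi.smul_apply, RatFunc.smul_eq_C_mul]
  rw [RatFunc.eval_mul]
  · simp
  · simp
  · rw [Polynomial.eval₂_id]; exact fun h => hf ⟨i, h⟩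

/-- The space `W γ`: the rational vectors `f` that lie, for all large `R`, in the closure of
`{g γ : g ∈ W}` in the Hilbert space of `L²` functions on the circle `|z| = R`; this closure is
`W̄ γ`, where `W̄` is the closure of `W`. -/
def loopAct (W : Submodule ℂ (RatVec r)) (γ : Loop r) : Submodule ℂ (RatVec r) where
  carrier := {f | ∀ᶠ R : ℝ in Filter.atTop, ∀ ε : ENNReal, 0 < ε →
    ∃ g ∈ W, circleNorm R (fun z => RatVec.eval f z - RatVec.eval g z ᵥ* γ.mat z) < ε}
  add_mem' := by
    intro f f' hf hf'
    filter_upwards [hf, hf', Filter.eventually_gt_atTop 0] with R h h' hR ε hε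
    obtain ⟨g, hg, hgε⟩ := h (ε / 2) (ENNReal.half_pos hε.ne')
    obtain ⟨g', hg', hgε'⟩ := h' (ε / 2) (ENNReal.half_pos hε.ne')
    refine ⟨g + g', W.add_mem hg hg', ?_⟩
    rw [circleNorm_congr (v := (fun z => RatVec.eval f z - RatVec.eval g z ᵥ* γ.mat z) +
      fun z => RatVec.eval f' z - RatVec.eval g' z ᵥ* γ.mat z) hR.ne'
      ((poles f ∪ poles f') ∪ (poles g ∪ poles g'))
      (((poles_finite f).union (poles_finite f')).union
        ((poles_finite g).union (poles_finite g')))]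
    · calc _ ≤ _ := circleNorm_add_le R
            ((measurable_eval f).sub (measurable_eval_loop g γ))
            ((measurable_eval f').sub (measurable_eval_loop g' γ))
        _ < ε / 2 + ε / 2 := ENNReal.add_lt_add hgε hgε'
        _ = ε := ENNReal.add_halves ε
    · intro z hz
      simp only [Set.mem_union, not_or] at hz
      rw [eval_add_of_notMem hz.1.1 hz.1.2, eval_add_of_notMem hz.2.1 hz.2.2, Matrix.add_vecMul]
      simp only [Pi.add_apply]
      abel
  zero_mem' := by
    refine Filter.Eventually.of_forall fun R ε hε => ⟨0, W.zero_mem, ?_⟩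
    have : (fun z => RatVec.eval (0 : RatVec r) z - RatVec.eval (0 : RatVec r) z ᵥ* γ.mat z)
        = (0 : ℂ) • (0 : ℂ → Fin r → ℂ) := by
      ext z i
      simp [RatVec.eval, Matrix.vecMul, dotProduct]
    rw [this, circleNorm_smul]
    simpa using hε
  smul_mem' := by
    intro c f hf
    filter_upwards [hf, Filter.eventually_gt_atTop 0] with R h hR ε hε
    obtain ⟨g, hg, hgε⟩ := h (ε / (‖c‖ₑ + 1)) (ENNReal.div_pos hε.ne' (by simp))
    refine ⟨c • g, W.smul_mem c hg, ?_⟩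
    rw [circleNorm_congr (v := c • fun z => RatVec.eval f z - RatVec.eval g z ᵥ* γ.mat z) hR.ne'
      (poles f ∪ poles g) ((poles_finite f).union (poles_finite g)), circleNorm_smul]
    · rw [ENNReal.lt_div_iff_mul_lt (by simp) (by simp)] at hgε
      refine lt_of_le_of_lt ?_ hgε
      rw [mul_comm]
      gcongr
      exact le_self_add
    · intro z hz
      simp only [Set.mem_union, not_or] at hz
      rw [eval_smul_of_notMem c hz.1, eval_smul_of_notMem c hz.2, Matrix.smul_vecMul, Pi.smul_apply,
        smul_sub]

/-! ### The map from `CMd` -/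

/-- The space attached to `(X, Y; v, w)` with `Y = diag(λ₁, …, λₙ)` and `Xᵢᵢ = αᵢ`: the rational
vectors `f` that are regular away from the `λᵢ` (and infinity), have at most a simple pole at
each `λᵢ`, and whose Laurent expansion `∑ₖ fₖ (z - λᵢ)^k` at each `λᵢ` is such that `f₋₁` is a
multiple of the row `vᵢ` and `(f₀ + αᵢ f₋₁) wᵢ = 0`. -/
def Quad.space (q : Quad n r) : Submodule ℂ (RatVec r) where
  carrier := {f |
    (∀ a : ℂ, (∀ i, a ≠ q.Y i i) → ∀ k : ℤ, k < 0 → vecCoeff a k f = 0) ∧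
    ∀ i, (∀ k : ℤ, k < -1 → vecCoeff (q.Y i i) k f = 0) ∧
      (∃ c : ℂ, vecCoeff (q.Y i i) (-1) f = c • q.v i) ∧
      (vecCoeff (q.Y i i) 0 f + q.X i i • vecCoeff (q.Y i i) (-1) f) ⬝ᵥ q.wᵀ i = 0}
  add_mem' := by
    rintro f g ⟨hf, hf'⟩ ⟨hg, hg'⟩
    refine ⟨fun a ha k hk => by rw [map_add, hf a ha k hk, hg a ha k hk, add_zero], fun i => ?_⟩
    obtain ⟨h1, ⟨c, h2⟩, h3⟩ := hf' i
    obtain ⟨h1', ⟨c', h2'⟩, h3'⟩ := hg' i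
    refine ⟨fun k hk => by rw [map_add, h1 k hk, h1' k hk, add_zero],
      ⟨c + c', by rw [map_add, h2, h2', add_smul]⟩, ?_⟩
    rw [map_add, map_add, smul_add, add_add_add_comm, add_dotProduct, h3, h3', add_zero]
  zero_mem' := ⟨fun _ _ _ _ => map_zero _, fun _ => ⟨fun _ _ => map_zero _, ⟨0, by simp⟩, by simp⟩⟩
  smul_mem' := by
    rintro c f ⟨hf, hf'⟩
    refine ⟨fun a ha k hk => by rw [map_smul, hf a ha k hk, smul_zero], fun i => ?_⟩
    obtain ⟨h1, ⟨d, h2⟩, h3⟩ := hf' i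
    refine ⟨fun k hk => by rw [map_smul, h1 k hk, smul_zero],
      ⟨c * d, by rw [map_smul, h2, mul_smul]⟩, ?_⟩
    rw [map_smul, map_smul, smul_comm (q.X i i) c, ← smul_add, smul_dotProduct, h3, smul_zero]

end

end VectorCM

/-! Let `d = ∏ᵢ (z - λᵢ)` and `cᵢ = d / (z - λᵢ)`. Every `f` in the space of `q` is `u / d` with `u`
a vector of polynomials, and the conditions at `λᵢ` only see the jet `(x, y) = (u(λᵢ), u'(λᵢ))`: `x`
is a multiple of `vᵢ` and `(y + sᵢ x) wᵢ = 0`, where `sᵢ = αᵢ - cᵢ'(λᵢ) / cᵢ(λᵢ)`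
(`DiagQuad.mem_space_iff`). Everything reduces to this jet condition and the relation `vᵢ wᵢ = -1`.

Rational Grassmannian: since `vᵢ wᵢ = -1`, the jet condition is the kernel of a linear map onto
`ℂ^r` (`DiagQuad.jetCond_iff`), and Hermite interpolation makes the conditions at different nodes
independent. The codimension in `d⁻¹ ℂ[z]^r` is therefore `n r = r deg d`.

Adelic Grassmannian: primary decomposability holds because the conditions are local. If an operator
of order at most `m` has top coefficient `b / d` and maps polynomials into the space, then applying
it to `(z - λᵢ)^m` and `(z - λᵢ)^(m+1)` shows that `b(λᵢ)` is a multiple of `vᵢ` and is killed by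
`wᵢ`, so it vanishes and `d` divides `b`. Conversely each polynomial vector `h` leads an operator `h
∂ + a`.

Equivariance: by the Leibniz rule `u γ` has the jet `(xγ, yγ + xγ')`, and the change of `Xᵢᵢ` under
`γ` is exactly what carries the jet condition of `q` to that of `q ∘ γ` (`DiagQuad.JetCond.loop`).
For `u / d` in the space of `q ∘ γ`, dividing the entire vector `u γ⁻¹` by `d²` leaves a polynomial
remainder with the correct jets; approximating the entire quotient by polynomials on a disc
approximates `u / d` by elements `g γ`. Conversely, `L²` limits on one large circle preserve
integrals against continuous functions: vanishing moments show that the limit is again polynomial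
over `d`, Cauchy's formulas recover its jets as limits of jets, and the jet condition is closed. -/

namespace VectorCM

open Polynomial

noncomputable section

variable {n r : ℕ}

/-! ### Laurent expansions of rational functions -/

open scoped RatFunc in
/-- The Laurent expansion at `a`. -/
def laurentHom (a : ℂ) : RatFunc ℂ →+* LaurentSeries ℂ :=
  (algebraMap (RatFunc ℂ) (LaurentSeries ℂ)).comp (RatFunc.laurent a : RatFunc ℂ →+* RatFunc ℂ)

theorem laurentHom_coeff (a : ℂ) (k : ℤ) (f : RatFunc ℂ) :
    (laurentHom a f).coeff k = laurentCoeff a k f := rfl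

open scoped RatFunc in
theorem laurentCoeff_algebraMap_sub_mul (a : ℂ) (k : ℤ) (f : RatFunc ℂ) :
    laurentCoeff a k (algebraMap _ _ (X - C a) * f) = laurentCoeff a (k - 1) f := by
  have h : laurentHom a (algebraMap _ _ (X - C a)) = HahnSeries.single 1 1 := by
    change algebraMap (RatFunc ℂ) (LaurentSeries ℂ)
      (RatFunc.laurent a (algebraMap _ _ (X - C a))) = _
    rw [RatFunc.laurent_algebraMap, show taylor a (X - C a) = X by simp, RatFunc.algebraMap_X]
    exact RatFunc.coe_X
  rw [← laurentHom_coeff, ← laurentHom_coeff, map_mul, h, HahnSeries.coeff_single_mul, one_mul]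

open scoped RatFunc in
/-- The Laurent expansion at `a` of a polynomial is its Taylor expansion. -/
theorem laurentHom_algebraMap (a : ℂ) (p : Polynomial ℂ) :
    laurentHom a (algebraMap _ _ p) =
      HahnSeries.ofPowerSeries ℤ ℂ (Polynomial.taylor a p : Polynomial ℂ) := by
  change algebraMap (RatFunc ℂ) (LaurentSeries ℂ) (RatFunc.laurent a (algebraMap _ _ p)) = _
  rw [RatFunc.laurent_algebraMap]
  exact (RatFunc.coe_coe _).symm

theorem ofPowerSeries_coeff_neg (P : PowerSeries ℂ) {k : ℤ} (hk : k < 0) :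
    (HahnSeries.ofPowerSeries ℤ ℂ P).coeff k = 0 := by
  rw [PowerSeries.coeff_coe, if_pos hk]

/-- A rational function whose Laurent expansion has no principal part expands into a power
series. -/
theorem exists_powerSeries {a : ℂ} {f : RatFunc ℂ} (h : ∀ k < 0, laurentCoeff a k f = 0) :
    ∃ P : PowerSeries ℂ, laurentHom a f = HahnSeries.ofPowerSeries ℤ ℂ P := by
  refine ⟨PowerSeries.mk fun m => laurentCoeff a m f, ?_⟩
  ext k
  rw [PowerSeries.coeff_coe]
  split_ifs with hk
  · exact h k hk
  · rw [PowerSeries.coeff_mk, Int.natAbs_of_nonneg (not_lt.1 hk)]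
    rfl

theorem laurentCoeff_algebraMap_mul_eq_zero {a : ℂ} {f : RatFunc ℂ}
    (h : ∀ k < 0, laurentCoeff a k f = 0) (p : Polynomial ℂ) {k : ℤ} (hk : k < 0) :
    laurentCoeff a k (algebraMap _ _ p * f) = 0 := by
  obtain ⟨P, hP⟩ := exists_powerSeries h
  rw [← laurentHom_coeff, map_mul, laurentHom_algebraMap, hP, ← map_mul]
  exact ofPowerSeries_coeff_neg _ hk

theorem taylor_constantCoeff (a : ℂ) (p : Polynomial ℂ) :
    PowerSeries.constantCoeff ((Polynomial.taylor a p : Polynomial ℂ) : PowerSeries ℂ) =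
      p.eval a := by
  rw [← PowerSeries.coeff_zero_eq_constantCoeff_apply, Polynomial.coeff_coe,
    Polynomial.taylor_coeff_zero]

/-- In `f * denom = num` both factors on the left expand into power series at `a`. A zero of the
denominator at `a` would thus be a zero of the numerator, against coprimality. -/
theorem denom_eval_ne_zero {a : ℂ} {f : RatFunc ℂ} (h : ∀ k < 0, laurentCoeff a k f = 0) :
    f.denom.eval a ≠ 0 := by
  intro h0
  obtain ⟨P, hP⟩ := exists_powerSeries h
  have e : f * algebraMap _ _ f.denom = algebraMap _ _ f.num := by
    conv_lhs => rw [← RatFunc.num_div_denom f]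
    rw [RatFunc.num_div_denom f]
    nth_rw 1 [← RatFunc.num_div_denom f]
    exact div_mul_cancel₀ _ (RatFunc.algebraMap_ne_zero f.denom_ne_zero)
  have e' := congrArg (laurentHom a) e
  rw [map_mul, hP, laurentHom_algebraMap, laurentHom_algebraMap,
    ← map_mul] at e'
  have e2 := congrArg PowerSeries.constantCoeff (HahnSeries.ofPowerSeries_injective e')
  rw [map_mul, taylor_constantCoeff, taylor_constantCoeff, h0, mul_zero] at e2
  obtain ⟨s, t, hst⟩ := f.isCoprime_num_denom
  have := congrArg (Polynomial.eval a) hst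
  simp [h0, ← e2] at this

/-- A rational function without poles is a polynomial. -/
theorem exists_eq_algebraMap {f : RatFunc ℂ} (h : ∀ a, f.denom.eval a ≠ 0) :
    ∃ p : Polynomial ℂ, f = algebraMap _ _ p := by
  have hd : f.denom.degree = 0 := by
    by_contra hd
    obtain ⟨a, ha⟩ := IsAlgClosed.exists_root f.denom hd
    exact h a ha
  have h1 : f.denom = 1 := f.monic_denom.natDegree_eq_zero.1
    (Polynomial.natDegree_eq_zero_iff_degree_le_zero.2 hd.le)
  refine ⟨f.num, ?_⟩
  conv_lhs => rw [← RatFunc.num_div_denom f, h1, map_one, div_one]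

/-- The first two Taylor coefficients of a quotient of polynomials. -/
theorem laurentCoeff_div {a : ℂ} (u d : Polynomial ℂ) (hd : d.eval a ≠ 0) :
    (∀ k < 0, laurentCoeff a k (algebraMap _ _ u / algebraMap _ _ d) = 0) ∧
    laurentCoeff a 0 (algebraMap _ _ u / algebraMap _ _ d) = u.eval a / d.eval a ∧
    laurentCoeff a 1 (algebraMap _ _ u / algebraMap _ _ d) =
      ((derivative u).eval a - (derivative d).eval a / d.eval a * u.eval a) / d.eval a := by
  have hd0 : d ≠ 0 := by rintro rfl; simp at hd
  set U : PowerSeries ℂ := ((taylor a u : Polynomial ℂ) : PowerSeries ℂ) with hU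
  set D : PowerSeries ℂ := ((taylor a d : Polynomial ℂ) : PowerSeries ℂ) with hD
  have hDinv : D * D⁻¹ = 1 := PowerSeries.mul_inv_cancel _ (by rwa [hD, taylor_constantCoeff])
  have e : (algebraMap _ (RatFunc ℂ) u / algebraMap _ _ d) * algebraMap _ _ d = algebraMap _ _ u :=
    div_mul_cancel₀ _ (RatFunc.algebraMap_ne_zero hd0)
  have e' := congrArg (laurentHom a) e
  rw [map_mul, laurentHom_algebraMap, laurentHom_algebraMap] at e'
  have hF : laurentHom a (algebraMap _ (RatFunc ℂ) u / algebraMap _ _ d) =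
      HahnSeries.ofPowerSeries ℤ ℂ (U * D⁻¹) := by
    rw [map_mul, ← e', mul_assoc, ← map_mul, hDinv, map_one, mul_one]
  have hP : (U * D⁻¹) * D = U := by rw [mul_assoc, mul_comm D⁻¹, hDinv, mul_one]
  have c0 : ∀ p : Polynomial ℂ, PowerSeries.coeff 0 ((taylor a p : Polynomial ℂ) : PowerSeries ℂ)
      = p.eval a := fun p => by rw [Polynomial.coeff_coe, taylor_coeff_zero]
  have c1 : ∀ p : Polynomial ℂ, PowerSeries.coeff 1 ((taylor a p : Polynomial ℂ) : PowerSeries ℂ)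
      = (derivative p).eval a := fun p => by rw [Polynomial.coeff_coe, taylor_coeff_one]
  have h0 : PowerSeries.coeff 0 (U * D⁻¹) = u.eval a / d.eval a := by
    rw [eq_div_iff hd, ← c0 u, ← c0 d, ← hU, ← hD]
    nth_rw 2 [← hP]
    simp [PowerSeries.coeff_mul]
  -- The coefficient of degree 1 in `(U * D⁻¹) * D = U`.
  have h1 : PowerSeries.coeff 1 (U * D⁻¹) * d.eval a + u.eval a / d.eval a * (derivative d).eval a
      = (derivative u).eval a := by
    rw [← h0, ← c0 d, ← c1 d, ← c1 u, ← hU, ← hD]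
    nth_rw 3 [← hP]
    rw [PowerSeries.coeff_mul (n := 1) (φ := U * D⁻¹)]
    simp [Finset.Nat.antidiagonal_succ, add_comm]
  refine ⟨fun k hk => ?_, ?_, ?_⟩
  · rw [← laurentHom_coeff, hF]
    exact ofPowerSeries_coeff_neg _ hk
  · rw [← h0]
    rw [← laurentHom_coeff, hF]
    exact LaurentSeries.coeff_coe_powerSeries _ 0
  · rw [eq_div_iff hd]
    have : laurentCoeff a 1 (algebraMap _ _ u / algebraMap _ _ d) =
        PowerSeries.coeff 1 (U * D⁻¹) := by
      rw [← laurentHom_coeff, hF]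
      exact LaurentSeries.coeff_coe_powerSeries _ 1
    rw [this]
    field_simp at h1 ⊢
    linear_combination h1

/-! ### Description of the spaces by jets of polynomials -/

/-- The eigenvalues `λᵢ`. -/
def DiagQuad.node (q : DiagQuad n r) (i : Fin n) : ℂ := q.1.1.Y i i

theorem DiagQuad.node_injective (q : DiagQuad n r) : Function.Injective q.node := by
  intro i j h
  by_contra hij
  exact diag_ne q hij (sub_eq_zero.2 h)

/-- The polynomial `∏ᵢ (z - λᵢ)`. -/
def DiagQuad.den (q : DiagQuad n r) : ℂ[X] := Lagrange.nodal Finset.univ q.node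

/-- The polynomial `∏_{j ≠ i} (z - λⱼ)`. -/
def DiagQuad.cof (q : DiagQuad n r) (i : Fin n) : ℂ[X] :=
  Lagrange.nodal (Finset.univ.erase i) q.node

theorem DiagQuad.den_eq (q : DiagQuad n r) (i : Fin n) :
    q.den = (X - C (q.node i)) * q.cof i :=
  Lagrange.nodal_eq_mul_nodal_erase (Finset.mem_univ i)

theorem DiagQuad.den_ne_zero (q : DiagQuad n r) : q.den ≠ 0 := Lagrange.nodal_ne_zero

theorem DiagQuad.natDegree_den (q : DiagQuad n r) : q.den.natDegree = n := by
  rw [DiagQuad.den, Lagrange.natDegree_nodal, Finset.card_fin]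

theorem DiagQuad.algebraMap_den_ne_zero (q : DiagQuad n r) :
    algebraMap ℂ[X] (RatFunc ℂ) q.den ≠ 0 := RatFunc.algebraMap_ne_zero q.den_ne_zero

theorem DiagQuad.eval_den_node (q : DiagQuad n r) (i : Fin n) : q.den.eval (q.node i) = 0 :=
  Lagrange.eval_nodal_at_node (Finset.mem_univ i)

theorem DiagQuad.eval_den_ne_zero (q : DiagQuad n r) {a : ℂ} (h : ∀ i, a ≠ q.node i) :
    q.den.eval a ≠ 0 :=
  Lagrange.eval_nodal_not_at_node fun i _ => h i

theorem DiagQuad.eval_cof_ne_zero (q : DiagQuad n r) (i : Fin n) :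
    (q.cof i).eval (q.node i) ≠ 0 :=
  Lagrange.eval_nodal_not_at_node fun _ hj =>
    q.node_injective.ne (Finset.ne_of_mem_erase hj).symm

theorem DiagQuad.eval_derivative_den (q : DiagQuad n r) (i : Fin n) :
    (derivative q.den).eval (q.node i) = (q.cof i).eval (q.node i) :=
  Lagrange.eval_nodal_derivative_eval_node_eq (Finset.mem_univ i)

theorem DiagQuad.den_dvd (q : DiagQuad n r) {p : ℂ[X]} (h : ∀ i, p.eval (q.node i) = 0) :
    q.den ∣ p := by
  rw [DiagQuad.den, Lagrange.nodal_eq]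
  refine Finset.prod_dvd_of_coprime ?_ fun i _ => dvd_iff_isRoot.2 (h i)
  intro i _ j _ hij
  exact isCoprime_X_sub_C_of_isUnit_sub (sub_ne_zero.2 (q.node_injective.ne hij)).isUnit

/-- The number `αᵢ - cᵢ'(λᵢ) / cᵢ(λᵢ)`, where `cᵢ = ∏_{j ≠ i} (z - λⱼ)`. -/
def DiagQuad.shift (q : DiagQuad n r) (i : Fin n) : ℂ :=
  q.1.1.X i i - (derivative (q.cof i)).eval (q.node i) / (q.cof i).eval (q.node i)

/-- The condition on `x = u(λᵢ)` and `y = u'(λᵢ)` for `u / ∏ (z - λⱼ)` to satisfy the conditions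
at `λᵢ` that define `Quad.space`. -/
def DiagQuad.JetCond (q : DiagQuad n r) (i : Fin n) (x y : Fin r → ℂ) : Prop :=
  (∃ c : ℂ, x = c • q.1.1.v i) ∧ (y + q.shift i • x) ⬝ᵥ q.1.1.wᵀ i = 0

/-- The value at a point of a vector of polynomials. -/
def vecEval (a : ℂ) (u : Fin r → ℂ[X]) : Fin r → ℂ := fun j => (u j).eval a

/-- The derivative at a point of a vector of polynomials. -/
def vecDeriv (a : ℂ) (u : Fin r → ℂ[X]) : Fin r → ℂ := fun j => (derivative (u j)).eval a

/-- The vector of rational functions `u / ∏ᵢ (z - λᵢ)`. -/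
def DiagQuad.overDen (q : DiagQuad n r) (u : Fin r → ℂ[X]) : RatVec r :=
  fun j => algebraMap _ _ (u j) / algebraMap _ _ q.den

theorem DiagQuad.sub_mul_overDen (q : DiagQuad n r) (u : Fin r → ℂ[X]) (i : Fin n) (j : Fin r) :
    algebraMap _ _ (X - C (q.node i)) * q.overDen u j =
      algebraMap _ _ (u j) / algebraMap _ _ (q.cof i) := by
  have h1 : algebraMap ℂ[X] (RatFunc ℂ) (X - C (q.node i)) ≠ 0 :=
    RatFunc.algebraMap_ne_zero (X_sub_C_ne_zero _)
  rw [DiagQuad.overDen, q.den_eq i, map_mul, ← mul_div_assoc, mul_div_mul_left _ _ h1]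

/-- Multiplying by `z - λᵢ` turns `u / d` into `u / cᵢ`, which is regular at `λᵢ`, so the Laurent
coefficients are Taylor coefficients of `u / cᵢ` moved by one. Differentiating `1 / cᵢ` produces the
correction contained in `DiagQuad.shift`. -/
theorem DiagQuad.vecCoeff_overDen (q : DiagQuad n r) (u : Fin r → ℂ[X]) (i : Fin n) :
    (∀ k < -1, vecCoeff (q.node i) k (q.overDen u) = 0) ∧
    vecCoeff (q.node i) (-1) (q.overDen u) =
      ((q.cof i).eval (q.node i))⁻¹ • vecEval (q.node i) u ∧
    vecCoeff (q.node i) 0 (q.overDen u) + q.1.1.X i i • vecCoeff (q.node i) (-1) (q.overDen u) =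
      ((q.cof i).eval (q.node i))⁻¹ •
        (vecDeriv (q.node i) u + q.shift i • vecEval (q.node i) u) := by
  have key : ∀ k j, vecCoeff (q.node i) k (q.overDen u) j = laurentCoeff (q.node i) (k + 1)
      (algebraMap _ _ (u j) / algebraMap _ _ (q.cof i)) := by
    intro k j
    rw [← sub_mul_overDen, laurentCoeff_algebraMap_sub_mul, add_sub_cancel_right]
    rfl
  have L := fun j => laurentCoeff_div (u j) (q.cof i) (q.eval_cof_ne_zero i)
  have hm : vecCoeff (q.node i) (-1) (q.overDen u) =
      ((q.cof i).eval (q.node i))⁻¹ • vecEval (q.node i) u := by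
    ext j
    rw [key, neg_add_cancel, (L j).2.1, Pi.smul_apply, smul_eq_mul, div_eq_inv_mul]
    rfl
  refine ⟨fun k hk => ?_, hm, ?_⟩
  · ext j
    rw [key, (L j).1 _ (by lia)]
    rfl
  · rw [hm]
    ext j
    rw [Pi.add_apply, key, zero_add, (L j).2.2]
    simp only [Pi.smul_apply, Pi.add_apply, smul_eq_mul, vecEval, vecDeriv, DiagQuad.shift]
    ring

theorem DiagQuad.vecCoeff_overDen_of_ne (q : DiagQuad n r) (u : Fin r → ℂ[X]) {a : ℂ}
    (ha : ∀ i, a ≠ q.node i) {k : ℤ} (hk : k < 0) : vecCoeff a k (q.overDen u) = 0 := by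
  ext j
  exact (laurentCoeff_div (u j) q.den (q.eval_den_ne_zero ha)).1 k hk

theorem DiagQuad.exists_eq_overDen (q : DiagQuad n r) {f : RatVec r}
    (hf : ∀ a : ℂ, (∀ i, a ≠ q.node i) → ∀ k : ℤ, k < 0 → vecCoeff a k f = 0)
    (hf' : ∀ i, ∀ k : ℤ, k < -1 → vecCoeff (q.node i) k f = 0) : ∃ u, f = q.overDen u := by
  have : ∀ j, ∃ p : ℂ[X], algebraMap _ _ q.den * f j = algebraMap _ _ p := by
    intro j
    refine exists_eq_algebraMap fun a => denom_eval_ne_zero fun k hk => ?_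
    by_cases ha : ∃ i, a = q.node i
    · obtain ⟨i, rfl⟩ := ha
      -- At a node the factor `z - λᵢ` already removes the simple pole, and the cofactor creates no
      -- new one.
      rw [q.den_eq i, mul_comm (X - C _), map_mul (algebraMap ℂ[X] (RatFunc ℂ)), mul_assoc]
      refine laurentCoeff_algebraMap_mul_eq_zero (fun k hk => ?_) _ hk
      rw [laurentCoeff_algebraMap_sub_mul]
      exact congrFun (hf' i (k - 1) (by lia)) j
    · push Not at ha
      exact laurentCoeff_algebraMap_mul_eq_zero (fun k hk => congrFun (hf a ha k hk) j) _ hk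
  choose u hu using this
  refine ⟨u, funext fun j => ?_⟩
  rw [DiagQuad.overDen, ← hu, mul_div_cancel_left₀ _ q.algebraMap_den_ne_zero]

theorem exists_smul_eq_smul_iff {c : ℂ} (hc : c ≠ 0) (x v : Fin r → ℂ) :
    (∃ d : ℂ, c⁻¹ • x = d • v) ↔ ∃ d : ℂ, x = d • v := by
  constructor
  · rintro ⟨d, hd⟩
    exact ⟨c * d, by rw [mul_smul, ← hd, smul_inv_smul₀ hc]⟩
  · rintro ⟨d, hd⟩
    exact ⟨c⁻¹ * d, by rw [mul_smul, hd]⟩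

theorem DiagQuad.overDen_mem_space_iff (q : DiagQuad n r) (u : Fin r → ℂ[X]) :
    q.overDen u ∈ q.1.1.space ↔
      ∀ i, q.JetCond i (vecEval (q.node i) u) (vecDeriv (q.node i) u) := by
  have h : q.overDen u ∈ q.1.1.space ↔
      (∀ a : ℂ, (∀ i, a ≠ q.node i) → ∀ k : ℤ, k < 0 → vecCoeff a k (q.overDen u) = 0) ∧
      ∀ i, (∀ k : ℤ, k < -1 → vecCoeff (q.node i) k (q.overDen u) = 0) ∧
        (∃ c : ℂ, vecCoeff (q.node i) (-1) (q.overDen u) = c • q.1.1.v i) ∧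
        (vecCoeff (q.node i) 0 (q.overDen u) + q.1.1.X i i •
          vecCoeff (q.node i) (-1) (q.overDen u)) ⬝ᵥ q.1.1.wᵀ i = 0 := Iff.rfl
  rw [h, and_iff_right fun a ha k hk => q.vecCoeff_overDen_of_ne u ha hk]
  refine forall_congr' fun i => ?_
  obtain ⟨h1, h2, h3⟩ := q.vecCoeff_overDen u i
  rw [and_iff_right h1, h3, h2, exists_smul_eq_smul_iff (q.eval_cof_ne_zero i), smul_dotProduct,
    smul_eq_zero_iff_right (inv_ne_zero (q.eval_cof_ne_zero i))]
  rfl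

theorem DiagQuad.mem_space_iff (q : DiagQuad n r) (f : RatVec r) :
    f ∈ q.1.1.space ↔ ∃ u, f = q.overDen u ∧
      ∀ i, q.JetCond i (vecEval (q.node i) u) (vecDeriv (q.node i) u) := by
  constructor
  · intro hf
    obtain ⟨u, rfl⟩ := q.exists_eq_overDen hf.1 fun i => (hf.2 i).1
    exact ⟨u, rfl, (q.overDen_mem_space_iff u).1 hf⟩
  · rintro ⟨u, rfl, hu⟩
    exact (q.overDen_mem_space_iff u).2 hu

theorem DiagQuad.mem_polyMultiples_inv_den (q : DiagQuad n r) (f : RatVec r) :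
    f ∈ polyMultiples r (algebraMap _ _ q.den)⁻¹ ↔ ∃ u, f = q.overDen u := by
  refine exists_congr fun u => ?_
  rw [funext_iff]
  refine forall_congr' fun j => ?_
  rw [DiagQuad.overDen, div_eq_inv_mul]

/-- Hermite interpolation of values and first derivatives at the `λᵢ`. -/
theorem DiagQuad.exists_hermite (q : DiagQuad n r) (x y : Fin n → Fin r → ℂ) :
    ∃ u : Fin r → ℂ[X], ∀ i, vecEval (q.node i) u = x i ∧ vecDeriv (q.node i) u = y i := by
  have hinj : Set.InjOn q.node (Finset.univ : Finset (Fin n)) := q.node_injective.injOn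
  let L : Fin r → ℂ[X] := fun j => Lagrange.interpolate Finset.univ q.node fun i => x i j
  -- `L` interpolates the values. Adding `d M` leaves them unchanged and adds `cᵢ(λᵢ) M(λᵢ)` to the
  -- derivative at `λᵢ`, which dictates the values of `M`.
  let M : Fin r → ℂ[X] := fun j => Lagrange.interpolate Finset.univ q.node fun i =>
    ((y i j) - (derivative (L j)).eval (q.node i)) / (q.cof i).eval (q.node i)
  have hL : ∀ i j, (L j).eval (q.node i) = x i j := fun i j =>
    Lagrange.eval_interpolate_at_node _ hinj (Finset.mem_univ i)
  have hM : ∀ i j, (M j).eval (q.node i) =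
      ((y i j) - (derivative (L j)).eval (q.node i)) / (q.cof i).eval (q.node i) := fun i j =>
    Lagrange.eval_interpolate_at_node _ hinj (Finset.mem_univ i)
  refine ⟨fun j => L j + q.den * M j, fun i => ⟨funext fun j => ?_, funext fun j => ?_⟩⟩
  · simp [vecEval, q.eval_den_node, hL]
  · have := q.eval_cof_ne_zero i
    simp only [vecDeriv, derivative_add, derivative_mul, eval_add, eval_mul, q.eval_den_node,
      q.eval_derivative_den, hM]
    field_simp
    ring

theorem vecEval_add (a : ℂ) (u u' : Fin r → ℂ[X]) :
    vecEval a (u + u') = vecEval a u + vecEval a u' := by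
  ext j; simp [vecEval]

theorem vecDeriv_add (a : ℂ) (u u' : Fin r → ℂ[X]) :
    vecDeriv a (u + u') = vecDeriv a u + vecDeriv a u' := by
  ext j; simp [vecDeriv]

theorem vecEval_smul (a c : ℂ) (u : Fin r → ℂ[X]) : vecEval a (c • u) = c • vecEval a u := by
  ext j; simp [vecEval]

theorem vecDeriv_smul (a c : ℂ) (u : Fin r → ℂ[X]) : vecDeriv a (c • u) = c • vecDeriv a u := by
  ext j; simp [vecDeriv]

/-! ### Fatness and the codimension -/

theorem DiagQuad.polyMultiples_den_le (q : DiagQuad n r) :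
    polyMultiples r (algebraMap _ _ q.den) ≤ q.1.1.space := by
  rintro f ⟨h, hf⟩
  have hd := q.algebraMap_den_ne_zero
  -- Here `d h = (d² h) / d`, and `d² h` has zero jet at every node.
  refine (q.mem_space_iff f).2 ⟨fun j => q.den * q.den * h j, funext fun j => ?_, fun i => ?_⟩
  · rw [hf, DiagQuad.overDen, map_mul, map_mul]
    field_simp
  · have h1 : vecEval (q.node i) (fun j => q.den * q.den * h j) = 0 := by
      ext j; simp [vecEval, q.eval_den_node]
    have h2 : vecDeriv (q.node i) (fun j => q.den * q.den * h j) = 0 := by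
      ext j; simp [vecDeriv, q.eval_den_node]
    rw [h1, h2]
    exact ⟨⟨0, by simp⟩, by simp⟩

theorem DiagQuad.space_le_polyMultiples (q : DiagQuad n r) :
    q.1.1.space ≤ polyMultiples r (algebraMap _ _ q.den)⁻¹ := by
  intro f hf
  obtain ⟨u, hu, -⟩ := (q.mem_space_iff f).1 hf
  exact (q.mem_polyMultiples_inv_den f).2 ⟨u, hu⟩

theorem DiagQuad.isFat_space (q : DiagQuad n r) : IsFat q.1.1.space :=
  ⟨q.den, q.den, q.den_ne_zero, q.den_ne_zero, q.polyMultiples_den_le, q.space_le_polyMultiples⟩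

/-- A map onto `ℂ^r` of jets `(x, y)` whose kernel is the space of the jets that satisfy
`DiagQuad.JetCond`. -/
def DiagQuad.jetDefect (q : DiagQuad n r) (i : Fin n) (x y : Fin r → ℂ) : Fin r → ℂ :=
  x + (x ⬝ᵥ q.1.1.wᵀ i) • q.1.1.v i + ((y + q.shift i • x) ⬝ᵥ q.1.1.wᵀ i) • q.1.1.v i

/-- Since `vᵢ wᵢ = -1`, the map `x ↦ x + (x wᵢ) vᵢ` is the projection onto the kernel of `wᵢ` along
`vᵢ`, while the last term of the defect lies along `vᵢ`. The two parts vanish separately and express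
the two halves of the jet condition. -/
theorem DiagQuad.jetCond_iff (q : DiagQuad n r) (i : Fin n) (x y : Fin r → ℂ) :
    q.JetCond i x y ↔ q.jetDefect i x y = 0 := by
  have hvw := diag_vw q i
  constructor
  · rintro ⟨⟨c, rfl⟩, h⟩
    rw [DiagQuad.jetDefect, h, smul_dotProduct, hvw]
    simp
  · intro h
    have h0 : (y + q.shift i • x) ⬝ᵥ q.1.1.wᵀ i = 0 := by
      have := congrArg (· ⬝ᵥ q.1.1.wᵀ i) h
      simp only [DiagQuad.jetDefect, add_dotProduct, smul_dotProduct, hvw, zero_dotProduct,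
        smul_eq_mul] at this ⊢
      linear_combination -this
    refine ⟨⟨-(x ⬝ᵥ q.1.1.wᵀ i), ?_⟩, h0⟩
    rw [DiagQuad.jetDefect, h0, zero_smul, add_zero] at h
    rw [neg_smul]
    exact eq_neg_of_add_eq_zero_left h

theorem DiagQuad.exists_jetDefect_eq (q : DiagQuad n r) (i : Fin n) (d : Fin r → ℂ) :
    ∃ x y, q.jetDefect i x y = d := by
  have hvw := diag_vw q i
  -- The vector `x` is the projection of `d` to the kernel of `wᵢ`, and `y` is chosen so that `y +
  -- sᵢ x = -d`, which restores the component of `d` along `vᵢ`.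
  refine ⟨d + (d ⬝ᵥ q.1.1.wᵀ i) • q.1.1.v i,
    -d - q.shift i • (d + (d ⬝ᵥ q.1.1.wᵀ i) • q.1.1.v i), ?_⟩
  rw [DiagQuad.jetDefect, sub_add_cancel, add_dotProduct, smul_dotProduct, hvw, neg_dotProduct]
  ext j
  simp

/-- The defects at all `λᵢ` of a vector of polynomials. -/
def DiagQuad.defect (q : DiagQuad n r) : (Fin r → ℂ[X]) →ₗ[ℂ] (Fin n → Fin r → ℂ) where
  toFun u i := q.jetDefect i (vecEval (q.node i) u) (vecDeriv (q.node i) u)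
  map_add' u u' := by
    ext i j
    simp only [vecEval_add, vecDeriv_add, DiagQuad.jetDefect, add_dotProduct, smul_dotProduct,
      smul_add, Pi.add_apply, Pi.smul_apply, smul_eq_mul]
    ring
  map_smul' c u := by
    ext i j
    simp only [vecEval_smul, vecDeriv_smul, DiagQuad.jetDefect, add_dotProduct, smul_dotProduct,
      Pi.add_apply, Pi.smul_apply, smul_eq_mul, RingHom.id_apply]
    ring

theorem DiagQuad.defect_surjective (q : DiagQuad n r) : Function.Surjective q.defect := by
  intro d
  choose x y h using fun i => q.exists_jetDefect_eq i (d i)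
  obtain ⟨u, hu⟩ := q.exists_hermite x y
  refine ⟨u, funext fun i => ?_⟩
  rw [← h i, ← (hu i).1, ← (hu i).2]
  rfl

theorem DiagQuad.overDen_mem_space_iff_defect (q : DiagQuad n r) (u : Fin r → ℂ[X]) :
    q.overDen u ∈ q.1.1.space ↔ q.defect u = 0 := by
  rw [q.overDen_mem_space_iff, funext_iff]
  exact forall_congr' fun i => q.jetCond_iff i _ _

theorem algebraMap_smul_div (c : ℂ) (p d : ℂ[X]) :
    (algebraMap _ (RatFunc ℂ) (c • p)) / algebraMap _ _ d =
      c • (algebraMap _ (RatFunc ℂ) p / algebraMap _ _ d) := by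
  rw [RatFunc.smul_eq_C_mul, Polynomial.smul_eq_C_mul, map_mul, RatFunc.algebraMap_C, mul_div_assoc]

/-- The linear map `u ↦ u / ∏ᵢ (z - λᵢ)`. -/
def DiagQuad.overDenHom (q : DiagQuad n r) :
    (Fin r → ℂ[X]) →ₗ[ℂ] ↥(polyMultiples r (algebraMap _ _ q.den)⁻¹) where
  toFun u := ⟨q.overDen u, (q.mem_polyMultiples_inv_den _).2 ⟨u, rfl⟩⟩
  map_add' u u' := by
    apply Subtype.ext
    ext1 j
    simp [DiagQuad.overDen, add_div]
  map_smul' c u := by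
    apply Subtype.ext
    ext1 j
    exact algebraMap_smul_div c (u j) q.den

/-- Both the quotient and the space of defects `(ℂ^r)^n` are images of the vectors of polynomials,
under maps with the same kernel. -/
theorem DiagQuad.finrank_quotient (q : DiagQuad n r) :
    Module.finrank ℂ (↥(polyMultiples r (algebraMap _ _ q.den)⁻¹) ⧸
      q.1.1.space.comap (polyMultiples r (algebraMap _ _ q.den)⁻¹).subtype) =
        r * q.den.natDegree := by
  set S := q.1.1.space.comap (polyMultiples r (algebraMap _ _ q.den)⁻¹).subtype with hS
  let ψ := S.mkQ ∘ₗ q.overDenHom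
  have hψ : Function.Surjective ψ := by
    refine S.mkQ_surjective.comp fun f => ?_
    obtain ⟨u, hu⟩ := (q.mem_polyMultiples_inv_den f.1).1 f.2
    exact ⟨u, Subtype.ext hu.symm⟩
  have hker : LinearMap.ker ψ = LinearMap.ker q.defect := by
    ext u
    rw [LinearMap.mem_ker, LinearMap.mem_ker, LinearMap.comp_apply, Submodule.mkQ_apply,
      Submodule.Quotient.mk_eq_zero, ← q.overDen_mem_space_iff_defect]
    rfl
  have e := (LinearMap.quotKerEquivOfSurjective ψ hψ).symm.trans
    ((Submodule.quotEquivOfEq _ _ hker).trans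
      (LinearMap.quotKerEquivOfSurjective q.defect q.defect_surjective))
  rw [e.finrank_eq, q.natDegree_den, Module.finrank_pi_fintype]
  simp [mul_comm]

theorem DiagQuad.space_mem_ratGr (q : DiagQuad n r) : q.1.1.space ∈ ratGr r :=
  ⟨q.den, q.den, q.den_ne_zero, q.den_ne_zero, q.polyMultiples_den_le, q.space_le_polyMultiples,
    q.finrank_quotient⟩

/-! ### Primary decomposition -/

theorem mem_orderGE {a : ℂ} {N : ℤ} {f : RatVec r} :
    f ∈ orderGE r a N ↔ ∀ k < N, vecCoeff a k f = 0 := by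
  simp [orderGE]

/-- The conditions at a point `a` that define `Quad.space`. -/
def DiagQuad.localSpace (q : DiagQuad n r) (a : ℂ) : Submodule ℂ (RatVec r) where
  carrier := {f | ((∀ i, a ≠ q.node i) → ∀ k : ℤ, k < 0 → vecCoeff a k f = 0) ∧
    ∀ i, a = q.node i → (∀ k : ℤ, k < -1 → vecCoeff a k f = 0) ∧
      (∃ c : ℂ, vecCoeff a (-1) f = c • q.1.1.v i) ∧
      (vecCoeff a 0 f + q.1.1.X i i • vecCoeff a (-1) f) ⬝ᵥ q.1.1.wᵀ i = 0}
  add_mem' := by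
    rintro f g ⟨hf, hf'⟩ ⟨hg, hg'⟩
    refine ⟨fun ha k hk => by rw [map_add, hf ha k hk, hg ha k hk, add_zero], fun i ha => ?_⟩
    obtain ⟨h1, ⟨c, h2⟩, h3⟩ := hf' i ha
    obtain ⟨h1', ⟨c', h2'⟩, h3'⟩ := hg' i ha
    refine ⟨fun k hk => by rw [map_add, h1 k hk, h1' k hk, add_zero],
      ⟨c + c', by rw [map_add, h2, h2', add_smul]⟩, ?_⟩
    rw [map_add, map_add, smul_add, add_add_add_comm, add_dotProduct, h3, h3', add_zero]
  zero_mem' := ⟨fun _ _ _ => map_zero _,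
    fun _ _ => ⟨fun _ _ => map_zero _, ⟨0, by simp⟩, by simp⟩⟩
  smul_mem' := by
    rintro c f ⟨hf, hf'⟩
    refine ⟨fun ha k hk => by rw [map_smul, hf ha k hk, smul_zero], fun i ha => ?_⟩
    obtain ⟨h1, ⟨d, h2⟩, h3⟩ := hf' i ha
    refine ⟨fun k hk => by rw [map_smul, h1 k hk, smul_zero],
      ⟨c * d, by rw [map_smul, h2, mul_smul]⟩, ?_⟩
    rw [map_smul, map_smul, smul_comm (q.1.1.X i i) c, ← smul_add, smul_dotProduct, h3, smul_zero]

theorem DiagQuad.isPrimaryDecomposable_space (q : DiagQuad n r) :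
    IsPrimaryDecomposable q.1.1.space := by
  -- The exponent 1 suffices: poles are at most simple, and a vector vanishing at `a` has `f₋₁ = f₀
  -- = 0`.
  refine ⟨Finset.univ.image q.node, 1, q.localSpace, fun a => ⟨fun f hf => ?_, fun f hf => ?_⟩,
    fun a ha => ?_, ?_⟩
  · rw [mem_orderGE] at hf
    push_cast at hf
    refine ⟨fun _ k hk => hf k (by lia), fun i _ => ⟨fun k hk => hf k (by lia), ⟨0, ?_⟩, ?_⟩⟩
    · rw [hf _ (by lia), zero_smul]
    · rw [hf _ (by lia), hf _ (by lia), smul_zero, add_zero, zero_dotProduct]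
  · rw [mem_orderGE]
    push_cast
    intro k hk
    by_cases h : ∃ i, a = q.node i
    · obtain ⟨i, hi⟩ := h
      exact (hf.2 i hi).1 k hk
    · push Not at h
      exact hf.1 h k (by lia)
  · have ha' : ∀ i, a ≠ q.node i := fun i h =>
      ha (Finset.mem_image.2 ⟨i, Finset.mem_univ i, h.symm⟩)
    ext f
    rw [mem_orderGE]
    exact ⟨fun h => h.1 ha', fun h => ⟨fun _ => h, fun i hi => absurd hi (ha' i)⟩⟩
  · ext f
    rw [Submodule.mem_iInf]
    constructor
    · rintro ⟨h1, h2⟩ a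
      exact ⟨fun ha => h1 a ha, fun i hi => by rw [hi]; exact h2 i⟩
    · intro h
      exact ⟨fun a ha => (h a).1 ha, fun i => (h (q.node i)).2 i rfl⟩

/-! ### Leading coefficients of differential operators -/

/-- The disjunction covers both uses: truncation by the degree of the polynomial and truncation by
the order of the operator. -/
theorem DiffOp.apply_eq_sum (D : DiffOp r) (p : ℂ[X]) (N : ℕ)
    (h : ∀ k, N ≤ k → D k = 0 ∨ derivative^[k] p = 0) :
    D.apply p = ∑ k ∈ Finset.range N, algebraMap ℂ[X] (RatFunc ℂ) (derivative^[k] p) • D k := by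
  rw [DiffOp.apply, Finsupp.sum]
  refine Finset.sum_congr_of_eq_on_inter ?_ ?_ fun _ _ _ => rfl
  · intro k _ hk
    rcases h k (by simpa using hk) with h | h <;> simp [h]
  · intro k _ hk
    rw [Finsupp.notMem_support_iff.1 hk, smul_zero]

theorem DiagQuad.overDen_sum (q : DiagQuad n r) (s : Finset ℕ) (p : ℕ → ℂ[X])
    (u : ℕ → Fin r → ℂ[X]) :
    ∑ k ∈ s, algebraMap ℂ[X] (RatFunc ℂ) (p k) • q.overDen (u k) =
      q.overDen (∑ k ∈ s, p k • u k) := by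
  ext1 j
  simp only [DiagQuad.overDen, Finset.sum_apply, Pi.smul_apply, smul_eq_mul, map_sum, map_mul,
    Finset.sum_div, mul_div_assoc]

theorem DiagQuad.overDen_sub (q : DiagQuad n r) (u u' : Fin r → ℂ[X]) :
    q.overDen (u - u') = q.overDen u - q.overDen u' := by
  ext1 j
  simp [DiagQuad.overDen, sub_div]

/-- The coefficients of an operator that maps polynomials to `Quad.space` have at most simple
poles at the `λᵢ`, and no other ones. -/
theorem DiagQuad.exists_coeff_eq_overDen (q : DiagQuad n r) {D : DiffOp r}
    (hD : D ∈ opsInto q.1.1.space) (k : ℕ) : ∃ b, D k = q.overDen b := by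
  induction k using Nat.strong_induction_on with
  | _ k ih =>
    -- Applied to `z^k`, the operator gives `k! D k` plus terms that involve only the `D j` with `j
    -- < k`, which have the desired form by induction.
    obtain ⟨U, hU, -⟩ := (q.mem_space_iff _).1 (hD (X ^ k))
    have hb : ∀ j : ℕ, ∃ b, j < k → D j = q.overDen b := fun j => by
      by_cases hj : j < k
      · obtain ⟨b, hb⟩ := ih j hj
        exact ⟨b, fun _ => hb⟩
      · exact ⟨0, fun h => absurd h hj⟩
    choose b hb using hb
    rw [D.apply_eq_sum (X ^ k) (k + 1) fun j hj => Or.inr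
      (iterate_derivative_eq_zero (by rw [natDegree_X_pow]; lia)), Finset.sum_range_succ,
      Finset.sum_congr rfl (fun j hj => by rw [hb j (Finset.mem_range.1 hj)]), q.overDen_sum,
      iterate_derivative_X_pow_eq_smul, Nat.sub_self, pow_zero, Nat.descFactorial_self] at hU
    set V := ∑ j ∈ Finset.range k, derivative^[j] (X ^ k : ℂ[X]) • b j with hV
    refine ⟨(C ((k.factorial : ℂ)⁻¹)) • (U - V), ?_⟩
    have h0 : (k.factorial : RatFunc ℂ) ≠ 0 := Nat.cast_ne_zero.2 k.factorial_ne_zero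
    have hk : D k = (k.factorial : RatFunc ℂ)⁻¹ • q.overDen (U - V) := by
      rw [q.overDen_sub, ← hU, add_sub_cancel_left, smul_eq_C_mul, mul_one,
        RatFunc.algebraMap_C, map_natCast, inv_smul_smul₀ h0]
    rw [hk]
    ext1 j
    simp [DiagQuad.overDen, mul_div_assoc]

theorem vecEval_sum (a : ℂ) (s : Finset ℕ) (p : ℕ → ℂ[X]) (u : ℕ → Fin r → ℂ[X]) :
    vecEval a (∑ k ∈ s, p k • u k) = ∑ k ∈ s, (p k).eval a • vecEval a (u k) := by
  ext j
  simp [vecEval, eval_finsetSum]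

theorem vecDeriv_sum (a : ℂ) (s : Finset ℕ) (p : ℕ → ℂ[X]) (u : ℕ → Fin r → ℂ[X]) :
    vecDeriv a (∑ k ∈ s, p k • u k) = ∑ k ∈ s,
      ((derivative (p k)).eval a • vecEval a (u k) + (p k).eval a • vecDeriv a (u k)) := by
  ext j
  simp [vecEval, vecDeriv, eval_finsetSum]

theorem eval_iterate_derivative_X_sub_C_pow (a : ℂ) (k m : ℕ) :
    (derivative^[k] ((X - C a) ^ m)).eval a = if k = m then (m.factorial : ℂ) else 0 := by
  rw [iterate_derivative_X_sub_pow]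
  split_ifs with h
  · subst h
    simp [Nat.descFactorial_self]
  · rcases lt_or_gt_of_ne h with h | h
    · have : m - k ≠ 0 := by lia
      simp [this]
    · simp [Nat.descFactorial_of_lt h]

/-- With `D m = b / d`, it suffices that `b` vanishes at every node. This follows from the jet
conditions for `D.p` with `p` a power of `z - λᵢ`. -/
theorem DiagQuad.leadingCoeff_eq_algebraMap (q : DiagQuad n r) {D : DiffOp r}
    (hD : D ∈ opsInto q.1.1.space) {m : ℕ} (hm : ∀ k, m < k → D k = 0) :
    ∃ h : Fin r → ℂ[X], ∀ j, D m j = algebraMap _ _ (h j) := by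
  choose b hb using q.exists_coeff_eq_overDen hD
  have happ : ∀ p, D.apply p =
      q.overDen (∑ k ∈ Finset.range (m + 1), derivative^[k] p • b k) := by
    intro p
    rw [D.apply_eq_sum p (m + 1) fun k hk => Or.inl (hm k (by lia)), ← q.overDen_sum]
    exact Finset.sum_congr rfl fun k _ => by rw [hb k]
  have hjet : ∀ p i, q.JetCond i
      (∑ k ∈ Finset.range (m + 1), (derivative^[k] p).eval (q.node i) • vecEval (q.node i) (b k))
      (∑ k ∈ Finset.range (m + 1),
        ((derivative^[k + 1] p).eval (q.node i) • vecEval (q.node i) (b k) +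
          (derivative^[k] p).eval (q.node i) • vecDeriv (q.node i) (b k))) := by
    intro p i
    have := hD p
    rw [happ, q.overDen_mem_space_iff] at this
    have := this i
    rw [vecEval_sum, vecDeriv_sum] at this
    simpa only [Function.iterate_succ_apply'] using this
  have hz : ∀ i, vecEval (q.node i) (b m) = 0 := by
    intro i
    -- For `(z - λᵢ)^m` the numerator of `D.p` has the value `m! b(λᵢ)` at `λᵢ`. For `(z -
    -- λᵢ)^(m+1)` its value is zero and its derivative is `(m+1)! b(λᵢ)`. Hence `b(λᵢ)` is a
    -- multiple of `vᵢ` orthogonal to `wᵢ`.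
    obtain ⟨⟨c, hc⟩, -⟩ := hjet ((X - C (q.node i)) ^ m) i
    obtain ⟨-, hw⟩ := hjet ((X - C (q.node i)) ^ (m + 1)) i
    simp only [eval_iterate_derivative_X_sub_C_pow] at hc hw
    have hs : ∀ k ∈ Finset.range (m + 1), k ≠ m + 1 := fun k hk =>
      (Finset.mem_range.1 hk).ne
    have hx : ∑ k ∈ Finset.range (m + 1), (if k = m + 1 then ((m + 1).factorial : ℂ) else 0) •
        vecEval (q.node i) (b k) = 0 :=
      Finset.sum_eq_zero fun k hk => by rw [if_neg (hs k hk), zero_smul]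
    have hy : ∀ k ∈ Finset.range (m + 1),
        (if k + 1 = m + 1 then ((m + 1).factorial : ℂ) else 0) • vecEval (q.node i) (b k) +
          (if k = m + 1 then ((m + 1).factorial : ℂ) else 0) • vecDeriv (q.node i) (b k) =
        (if k = m then ((m + 1).factorial : ℂ) else 0) • vecEval (q.node i) (b k) := fun k hk => by
      rw [if_neg (hs k hk), zero_smul, add_zero]
      simp only [add_left_inj]
    rw [hx, smul_zero, add_zero, Finset.sum_congr rfl hy] at hw
    simp only [ite_smul, zero_smul, Finset.sum_ite_eq', Finset.mem_range, Nat.lt_succ_self,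
      if_true, smul_dotProduct, smul_eq_mul] at hc hw
    have h1 : vecEval (q.node i) (b m) ⬝ᵥ q.1.1.wᵀ i = 0 :=
      (mul_eq_zero.1 hw).resolve_left (Nat.cast_ne_zero.2 (m + 1).factorial_ne_zero)
    -- Pairing with `wᵢ` turns `vᵢ` into `-1`.
    have h2 : c = 0 := by
      have := congrArg (· ⬝ᵥ q.1.1.wᵀ i) hc
      simpa [smul_dotProduct, h1, diag_vw] using this
    rw [h2, zero_smul] at hc
    exact (smul_eq_zero.1 hc).resolve_left (Nat.cast_ne_zero.2 m.factorial_ne_zero)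
  have hdvd : ∀ j, q.den ∣ b m j := fun j => q.den_dvd fun i => congrFun (hz i) j
  choose h hh using hdvd
  refine ⟨h, fun j => ?_⟩
  rw [hb, DiagQuad.overDen, hh, map_mul, mul_div_cancel_left₀ _ q.algebraMap_den_ne_zero]

/-- Every vector `h` of polynomials is the leading coefficient of an operator `h ∂ + a` that maps
polynomials to `Quad.space`. -/
theorem DiagQuad.exists_leadingCoeff_eq (q : DiagQuad n r) (h : Fin r → ℂ[X]) :
    ∃ D ∈ opsInto q.1.1.space, (∀ k, 1 < k → D k = 0) ∧ D 1 = fun j => algebraMap _ _ (h j) := by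
  -- For `D = h ∂ + b / d`, the numerator of `D.p` is `p b + d p' h`. Its jet condition at `λᵢ` must
  -- hold for all `p(λᵢ)` and `p'(λᵢ)`. The terms in `p` vanish if `b' = -sᵢ b` there, and those in
  -- `p'` if `(b + cᵢ h) wᵢ = 0`. Requiring `b(λᵢ)` to be a multiple of `vᵢ`, with `vᵢ wᵢ = -1`,
  -- determines it as `ρ i`.
  let ρ : Fin n → Fin r → ℂ := fun i =>
    ((q.cof i).eval (q.node i) * (vecEval (q.node i) h ⬝ᵥ q.1.1.wᵀ i)) • q.1.1.v i
  obtain ⟨b, hb⟩ := q.exists_hermite ρ fun i => -q.shift i • ρ i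
  refine ⟨Finsupp.single 0 (q.overDen b) + Finsupp.single 1 fun j => algebraMap _ _ (h j),
    fun p => ?_, fun k hk => ?_, ?_⟩
  · rw [DiffOp.apply_eq_sum _ p 2 fun k hk => Or.inl ?_]
    · have e : ∑ k ∈ Finset.range 2, algebraMap ℂ[X] (RatFunc ℂ) (derivative^[k] p) •
          (Finsupp.single 0 (q.overDen b) +
            Finsupp.single 1 fun j => algebraMap ℂ[X] (RatFunc ℂ) (h j) : DiffOp r) k =
          q.overDen (p • b + (q.den * derivative p) • h) := by
        have hd := q.algebraMap_den_ne_zero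
        ext1 j
        simp [Finset.sum_range_succ, DiagQuad.overDen, -algebraMap_smul]
        field_simp
      rw [e, q.overDen_mem_space_iff]
      intro i
      have h1 : vecEval (q.node i) (p • b + (q.den * derivative p) • h) =
          p.eval (q.node i) • ρ i := by
        rw [← (hb i).1]
        ext j
        simp [vecEval, q.eval_den_node]
      have h2 : vecDeriv (q.node i) (p • b + (q.den * derivative p) • h) =
          (derivative p).eval (q.node i) • ρ i - (p.eval (q.node i) * q.shift i) • ρ i +
            ((q.cof i).eval (q.node i) * (derivative p).eval (q.node i)) •
              vecEval (q.node i) h := by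
        have h3 := (hb i).2
        rw [← (hb i).1] at h3 ⊢
        ext j
        have h4 := congrFun h3 j
        simp only [vecDeriv, vecEval, Pi.smul_apply, smul_eq_mul] at h4
        simp only [vecDeriv, vecEval, Pi.add_apply, Pi.sub_apply, Pi.smul_apply, smul_eq_mul,
          derivative_add, derivative_mul, eval_add, eval_mul, q.eval_den_node,
          q.eval_derivative_den, h4]
        ring
      rw [h1, h2]
      refine ⟨⟨_, smul_smul _ _ _⟩, ?_⟩
      simp only [add_dotProduct, sub_dotProduct, smul_dotProduct, smul_eq_mul, ρ, diag_vw]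
      ring
    · simp [show 0 ≠ k by lia, show 1 ≠ k by lia]
  · simp [show 0 ≠ k by lia, show 1 ≠ k by lia]
  · simp

theorem DiagQuad.space_mem_adelicGr (q : DiagQuad n r) : q.1.1.space ∈ adelicGr r := by
  refine ⟨q.isFat_space, q.isPrimaryDecomposable_space, Set.ext fun a => ⟨?_, ?_⟩⟩
  · rintro ⟨D, hD, m, hm, rfl⟩
    exact q.leadingCoeff_eq_algebraMap hD hm
  · rintro ⟨h, hh⟩
    obtain ⟨D, hD, hk, h1⟩ := q.exists_leadingCoeff_eq h
    exact ⟨D, hD, 1, hk, h1.trans (funext hh).symm⟩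

/-! ### Independence of the representative -/

theorem exists_entry_ne_zero {A B : Matrix (Fin n) (Fin n) ℂ} (h : A * B = 1) (i : Fin n) :
    ∃ j, A i j ≠ 0 := by
  by_contra! hA
  have := congrFun (congrFun h i) i
  simp [Matrix.mul_apply, hA] at this

/-- A matrix that conjugates one diagonal matrix with distinct entries into another is a permutation
matrix with rescaled entries. It permutes the nodes and the `Xᵢᵢ`, and rescales `vᵢ` and `wᵢ` by
inverse scalars, to which the defining conditions are insensitive. The inverse matrix gives the
other inclusion. -/
theorem DiagQuad.space_le_of_smul_eq {q₁ q₂ : DiagQuad n r} {g : GL (Fin n) ℂ}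
    (h : g • q₁.1.1 = q₂.1.1) : q₁.1.1.space ≤ q₂.1.1.space := by
  set G := (g : Matrix (Fin n) (Fin n) ℂ) with hG
  set K := ((g⁻¹ : GL (Fin n) ℂ) : Matrix (Fin n) (Fin n) ℂ) with hK
  have hGK : G * K = 1 := by rw [hG, hK, ← Units.val_mul, mul_inv_cancel, Units.val_one]
  have hKG : K * G = 1 := by rw [hG, hK, ← Units.val_mul, inv_mul_cancel, Units.val_one]
  rintro f ⟨hf, hf'⟩
  refine ⟨fun a ha => hf a fun j hj => ?_, fun i => ?_⟩
  · obtain ⟨i, hi⟩ := exists_entry_ne_zero hKG j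
    exact ha i (hj.trans (smul_intertwine_inv h hi))
  obtain ⟨j, hj⟩ := exists_entry_ne_zero hGK i
  have hnode : q₁.node j = q₂.node i := smul_intertwine h hj
  have hG0 : ∀ k, k ≠ j → G i k = 0 := fun k hk => by
    by_contra hne
    exact hk (q₁.node_injective ((smul_intertwine h hne).trans hnode.symm))
  have hK0 : ∀ k, k ≠ j → K k i = 0 := fun k hk => by
    by_contra hne
    exact hk (q₁.node_injective ((smul_intertwine_inv h hne).trans hnode.symm))
  have h1 : G i j * K j i = 1 := by
    have := congrFun (congrFun hGK i) i
    rwa [Matrix.mul_apply, Finset.sum_eq_single j (fun k _ hk => by rw [hG0 k hk, zero_mul])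
      (fun hj => absurd (Finset.mem_univ j) hj), Matrix.one_apply_eq] at this
  have hv : q₂.1.1.v i = G i j • q₁.1.1.v j := by
    ext m
    rw [← h, smul_v, Matrix.mul_apply, Finset.sum_eq_single j
      (fun k _ hk => by rw [← hG, hG0 k hk, zero_mul]) (fun hj => absurd (Finset.mem_univ j) hj)]
    rfl
  have hw : q₂.1.1.wᵀ i = K j i • q₁.1.1.wᵀ j := by
    ext m
    rw [← h, Matrix.transpose_apply, smul_w, Matrix.mul_apply, Finset.sum_eq_single j
      (fun k _ hk => by rw [← hK, hK0 k hk, mul_zero]) (fun hj => absurd (Finset.mem_univ j) hj),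
      mul_comm]
    rfl
  have hX : q₂.1.1.X i i = q₁.1.1.X j j := by
    rw [← h, smul_X, Matrix.mul_apply, Finset.sum_eq_single j
      (fun k _ hk => by rw [← hK, hK0 k hk, mul_zero]) (fun hj => absurd (Finset.mem_univ j) hj),
      Matrix.mul_apply, Finset.sum_eq_single j
      (fun k _ hk => by rw [← hG, hG0 k hk, zero_mul]) (fun hj => absurd (Finset.mem_univ j) hj),
      ← hG, ← hK]
    linear_combination q₁.1.1.X j j * h1
  obtain ⟨f1, ⟨c, f2⟩, f3⟩ := hf' j
  have hY : q₂.1.1.Y i i = q₁.1.1.Y j j := hnode.symm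
  rw [hY, hX, hv, hw]
  refine ⟨f1, ⟨c * K j i, ?_⟩, ?_⟩
  · rw [f2, smul_smul, mul_assoc, mul_comm (K j i), h1, mul_one]
  · rw [dotProduct_smul, f3, smul_zero]

theorem DiagQuad.space_eq_of_toCMd_eq {q₁ q₂ : DiagQuad n r} (h : q₁.toCMd = q₂.toCMd) :
    q₁.1.1.space = q₂.1.1.space := by
  obtain ⟨g, hg⟩ := DiagQuad.exists_smul h
  obtain ⟨g', hg'⟩ := DiagQuad.exists_smul h.symm
  exact le_antisymm (DiagQuad.space_le_of_smul_eq hg) (DiagQuad.space_le_of_smul_eq hg')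

/-! ### Loops acting on jets -/

/-- The new jet is that of `u γ`. Pairing `xγ'` with `γ⁻¹ wᵢ` for `x = c vᵢ` adds `c vᵢ γ' γ⁻¹ wᵢ`,
and the change of `Xᵢᵢ` contributes the opposite because `x wᵢ = -c`. The cofactor part of the shift
is unchanged, as `Y` is. -/
theorem DiagQuad.JetCond.loop {q : DiagQuad n r} {i : Fin n} {x y : Fin r → ℂ}
    (h : q.JetCond i x y) (γ : Loop r) :
    (q.loop γ).JetCond i (x ᵥ* γ.mat (q.node i))
      (y ᵥ* γ.mat (q.node i) + x ᵥ* γ.der (q.node i)) := by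
  obtain ⟨⟨c, rfl⟩, h⟩ := h
  have hv : (q.loop γ).1.1.v i = q.1.1.v i ᵥ* γ.mat (q.node i) := rfl
  have hw : (q.loop γ).1.1.wᵀ i = (γ.mat (q.node i))⁻¹ *ᵥ q.1.1.wᵀ i := rfl
  have hs : (q.loop γ).shift i = q.shift i +
      q.1.1.v i ⬝ᵥ ((γ.der (q.node i) * (γ.mat (q.node i))⁻¹) *ᵥ q.1.1.wᵀ i) := by
    change (q.1.1.loop γ).X i i - _ = _
    rw [loop_X_diag, DiagQuad.shift, add_sub_right_comm]
    rfl
  refine ⟨⟨c, by rw [hv, Matrix.smul_vecMul]⟩, ?_⟩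
  have hG : ∀ x : Fin r → ℂ, (x ᵥ* γ.mat (q.node i)) ⬝ᵥ ((γ.mat (q.node i))⁻¹ *ᵥ q.1.1.wᵀ i) =
      x ⬝ᵥ q.1.1.wᵀ i := fun x => by
    rw [← Matrix.dotProduct_mulVec, Matrix.mulVec_mulVec,
      Matrix.mul_nonsing_inv _ (γ.isUnit_det _), Matrix.one_mulVec]
  have hd : ∀ x : Fin r → ℂ, (x ᵥ* γ.der (q.node i)) ⬝ᵥ ((γ.mat (q.node i))⁻¹ *ᵥ q.1.1.wᵀ i) =
      x ⬝ᵥ ((γ.der (q.node i) * (γ.mat (q.node i))⁻¹) *ᵥ q.1.1.wᵀ i) := fun x => by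
    rw [← Matrix.dotProduct_mulVec, Matrix.mulVec_mulVec]
  have hvw := diag_vw q i
  rw [hw, hs, add_dotProduct, add_dotProduct, smul_dotProduct, hG, hG, hd]
  simp only [add_dotProduct, smul_dotProduct, smul_eq_mul, hvw] at h ⊢
  linear_combination h

theorem Loop.hasDerivAt (γ : Loop r) (z : ℂ) (k j : Fin r) :
    HasDerivAt (fun t => γ.mat t k j) (γ.der z k j) z :=
  (γ.2 k j z).hasDerivAt

theorem Loop.mat_inv_mul (γ : Loop r) (z : ℂ) : (γ⁻¹).mat z * γ.mat z = 1 := by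
  rw [← Loop.mat_mul, inv_mul_cancel, Loop.mat_one]

theorem hasDerivAt_vecEval_vecMul (u : Fin r → ℂ[X]) (γ : Loop r) (z : ℂ) (j : Fin r) :
    HasDerivAt (fun t => (vecEval t u ᵥ* γ.mat t) j)
      ((vecDeriv z u ᵥ* γ.mat z + vecEval z u ᵥ* γ.der z) j) z := by
  simp only [Matrix.vecMul, dotProduct, Pi.add_apply, ← Finset.sum_add_distrib]
  exact HasDerivAt.fun_sum fun k _ => ((u k).hasDerivAt z).mul (γ.hasDerivAt z k j)

/-! ### Approximation of entire functions -/

/-- Division of an entire function by a polynomial. -/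
theorem exists_eq_add_mul_entire (S : Multiset ℂ) {F : ℂ → ℂ} (hF : Differentiable ℂ F) :
    ∃ (t : ℂ[X]) (E : ℂ → ℂ), Differentiable ℂ E ∧
      ∀ z, F z = t.eval z + ((S.map fun a => X - C a).prod).eval z * E z := by
  induction S using Multiset.induction generalizing F with
  | empty => exact ⟨0, F, hF, fun z => by simp⟩
  | cons a S ih =>
    -- One root is split off at a time, `F(z) = F(a) + (z - a) E(z)` with `E` the entire difference
    -- quotient. Repeated roots are allowed, as needed for division by `d²`.
    have hd : Differentiable ℂ (dslope F a) := by
      rw [← differentiableOn_univ] at hF ⊢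
      exact (Complex.differentiableOn_dslope Filter.univ_mem).2 hF
    obtain ⟨t, E, hE, h⟩ := ih hd
    refine ⟨C (F a) + (X - C a) * t, E, hE, fun z => ?_⟩
    have := sub_smul_dslope F a z
    rw [smul_eq_mul, h z] at this
    simp only [Multiset.map_cons, Multiset.prod_cons, eval_add, eval_mul, eval_sub, eval_X, eval_C]
    linear_combination -this

/-- An entire function is a uniform limit of polynomials on every disc. -/
theorem exists_polynomial_near {F : ℂ → ℂ} (hF : Differentiable ℂ F) (R : ℝ) {ε : ℝ}
    (hε : 0 < ε) : ∃ s : ℂ[X], ∀ z, ‖z‖ ≤ R → ‖F z - s.eval z‖ ≤ ε := by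
  -- The Taylor series at 0 converges on the whole plane. The radius `R + 1` is taken so that the
  -- closed disc of radius `R` lies in the open one where convergence is uniform.
  have h := (hF.hasFPowerSeriesOnBall 0 (R := 1) one_pos).tendstoUniformlyOn
    (r' := (R + 1).toNNReal) ENNReal.coe_lt_top
  obtain ⟨N, hN⟩ := (Metric.tendstoUniformlyOn_iff.1 h ε hε).exists
  refine ⟨∑ k ∈ Finset.range N, C ((cauchyPowerSeries F 0 1).coeff k) * X ^ k, fun z hz => ?_⟩
  have := hN z (by
    rw [mem_ball_zero_iff]
    exact lt_of_lt_of_le (by linarith) (Real.le_coe_toNNReal _))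
  rw [zero_add, dist_eq_norm] at this
  refine le_trans (le_of_eq ?_) this.le
  congr 2
  simp only [FormalMultilinearSeries.partialSum, eval_finsetSum, eval_mul, eval_C, eval_pow,
    eval_X]
  refine Finset.sum_congr rfl fun k _ => ?_
  rw [FormalMultilinearSeries.apply_eq_pow_smul_coeff, smul_eq_mul, mul_comm, NNReal.coe_one]

/-! ### Norms on circles -/

theorem norm_toLp_le {x : Fin r → ℂ} {η : ℝ} (h : ∀ j, ‖x j‖ ≤ η) :
    ‖(WithLp.toLp 2 x : EuclideanSpace ℂ (Fin r))‖ ≤ √(r * η ^ 2) := by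
  rw [EuclideanSpace.norm_eq]
  refine Real.sqrt_le_sqrt ?_
  calc ∑ j, ‖x j‖ ^ 2 ≤ ∑ _j : Fin r, η ^ 2 :=
        Finset.sum_le_sum fun j _ => pow_le_pow_left₀ (norm_nonneg _) (h j) 2
    _ = _ := by simp

/-- A bound `η` on the entries bounds the norm by a constant times `√(r η²)`, which tends to 0 with
`η`. -/
theorem exists_circleNorm_lt (r : ℕ) {R : ℝ} (hR : 0 < R) {ε : ENNReal} (hε : 0 < ε) :
    ∃ η : ℝ, 0 < η ∧ ∀ u : ℂ → Fin r → ℂ, (∀ z, ‖z‖ = R → ∀ j, ‖u z j‖ ≤ η) →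
      circleNorm R u < ε := by
  set K := (MeasureTheory.volume.restrict (Set.Ioc (0 : ℝ) (2 * Real.pi))) Set.univ ^
    (2 : ENNReal).toReal⁻¹ with hK
  have hKtop : K ≠ ⊤ := ENNReal.rpow_ne_top_of_nonneg (by positivity)
    (MeasureTheory.measure_ne_top _ _)
  have ht : Filter.Tendsto (fun η : ℝ => K * ENNReal.ofReal √(r * η ^ 2)) (nhds 0)
      (nhds (K * ENNReal.ofReal √(r * (0 : ℝ) ^ 2))) := by
    refine ENNReal.Tendsto.const_mul ?_ (Or.inr hKtop)
    exact (ENNReal.continuous_ofReal.comp (by fun_prop)).tendsto 0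
  simp only [ne_eq, OfNat.ofNat_ne_zero, not_false_eq_true, zero_pow, mul_zero, Real.sqrt_zero,
    ENNReal.ofReal_zero] at ht
  have he := ((ht.eventually_lt_const hε).filter_mono nhdsWithin_le_nhds).and
    (self_mem_nhdsWithin (s := Set.Ioi (0 : ℝ)))
  obtain ⟨η, h1, h2⟩ := he.exists
  refine ⟨η, h2, fun u hu => lt_of_le_of_lt ?_ h1⟩
  exact MeasureTheory.eLpNorm_le_of_ae_bound (Filter.Eventually.of_forall fun θ =>
    norm_toLp_le (hu _ (by rw [norm_circleMap_zero, abs_of_pos hR])))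

/-- Integration over a circle against a bounded function is continuous for `circleNorm`. -/
theorem enorm_circleIntegral_le {R : ℝ} (hR : 0 < R) {φ : ℂ → ℂ} {M : ℝ}
    (hM : ∀ z, ‖z‖ = R → ‖φ z‖ ≤ M) {u : ℂ → Fin r → ℂ} (hu : Measurable u) (j : Fin r) :
    ‖∮ z in C(0, R), φ z * u z j‖ₑ ≤ ENNReal.ofReal (R * M) * (circleNorm R u *
      (MeasureTheory.volume.restrict (Set.Ioc (0 : ℝ) (2 * Real.pi))) Set.univ ^
        (1 / (1 : ENNReal).toReal - 1 / (2 : ENNReal).toReal)) := by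
  have hmeas : MeasureTheory.AEStronglyMeasurable
      (fun θ : ℝ => (WithLp.toLp 2 (u (circleMap 0 R θ)) : EuclideanSpace ℂ (Fin r)))
      (MeasureTheory.volume.restrict (Set.Ioc 0 (2 * Real.pi))) :=
    ((WithLp.measurable_toLp 2 _).comp
      (hu.comp (continuous_circleMap 0 R).measurable)).aestronglyMeasurable
  rw [circleIntegral, intervalIntegral.integral_of_le Real.two_pi_pos.le]
  refine (MeasureTheory.enorm_integral_le_lintegral_enorm _).trans ?_
  -- By Hölder's inequality the `L¹` norm is at most the `L²` norm times a power of the total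
  -- measure.
  refine le_trans ?_ (mul_le_mul_right
    (MeasureTheory.eLpNorm_le_eLpNorm_mul_rpow_measure_univ one_le_two hmeas) _)
  rw [MeasureTheory.eLpNorm_one_eq_lintegral_enorm,
    ← MeasureTheory.lintegral_const_mul' _ _ ENNReal.ofReal_ne_top]
  refine MeasureTheory.lintegral_mono fun θ => ?_
  have hz : ‖circleMap 0 R θ‖ = R := by rw [norm_circleMap_zero, abs_of_pos hR]
  have h1 : ‖u (circleMap 0 R θ) j‖ ≤
      ‖(WithLp.toLp 2 (u (circleMap 0 R θ)) : EuclideanSpace ℂ (Fin r))‖ :=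
    PiLp.norm_apply_le (WithLp.toLp 2 (u (circleMap 0 R θ)) : EuclideanSpace ℂ (Fin r)) j
  have hM0 : 0 ≤ M := (norm_nonneg _).trans (hM _ hz)
  rw [← ofReal_norm, ← ofReal_norm, ← ENNReal.ofReal_mul (by positivity)]
  refine ENNReal.ofReal_le_ofReal ?_
  rw [deriv_circleMap, norm_smul, norm_mul, norm_mul, Complex.norm_I, mul_one, hz, mul_assoc]
  gcongr
  exact hM _ hz

/-! ### The action of loops on the spaces -/

/-- `RatFunc.eval` uses the fraction in lowest terms, whose denominator divides `d` and so does not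
vanish at `z` either. -/
theorem eval_eq_div {f : RatFunc ℂ} {p d : ℂ[X]} (h : f = algebraMap _ _ p / algebraMap _ _ d)
    {z : ℂ} (hz : d.eval z ≠ 0) : f.eval (RingHom.id ℂ) z = p.eval z / d.eval z := by
  have hd : d ≠ 0 := by rintro rfl; simp at hz
  have hfd : f.denom ∣ d := by rw [h]; exact RatFunc.denom_div_dvd p d
  have hfz : f.denom.eval z ≠ 0 := by
    obtain ⟨e, he⟩ := hfd
    intro h0
    rw [he, eval_mul, h0, zero_mul] at hz
    exact hz rfl
  have e : f.num * d = p * f.denom := by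
    apply RatFunc.algebraMap_injective ℂ
    rw [map_mul, map_mul]
    have := h
    rw [← RatFunc.num_div_denom f] at this
    exact (div_eq_div_iff (RatFunc.algebraMap_ne_zero f.denom_ne_zero)
      (RatFunc.algebraMap_ne_zero hd)).1 this
  rw [RatFunc.eval, eval₂_id, eval₂_id, div_eq_div_iff hfz hz, ← eval_mul, ← eval_mul, e]

theorem DiagQuad.eval_overDen (q : DiagQuad n r) (u : Fin r → ℂ[X]) {z : ℂ}
    (hz : q.den.eval z ≠ 0) :
    RatVec.eval (q.overDen u) z = (q.den.eval z)⁻¹ • vecEval z u := by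
  ext j
  rw [RatVec.eval, eval_eq_div (f := q.overDen u j) (p := u j) rfl hz, Pi.smul_apply, smul_eq_mul,
    div_eq_inv_mul]
  rfl

theorem DiagQuad.eval_den_ne_zero_of_norm_eq (q : DiagQuad n r) {R : ℝ}
    (hR : ∀ i, ‖q.node i‖ < R) {z : ℂ} (hz : ‖z‖ = R) : q.den.eval z ≠ 0 :=
  q.eval_den_ne_zero fun i h => (hR i).ne (h ▸ hz)

theorem continuousOn_eval (f : RatVec r) {s : Set ℂ} (h : ∀ z ∈ s, z ∉ poles f) (j : Fin r) :
    ContinuousOn (fun z => RatVec.eval f z j) s := by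
  simp only [RatVec.eval, RatFunc.eval, eval₂_id]
  exact (Polynomial.continuous _).continuousOn.div (Polynomial.continuous _).continuousOn
    fun z hz h0 => h z hz ⟨j, h0⟩

theorem continuousOn_eval_vecMul {f : RatVec r} (γ : Loop r) {s : Set ℂ}
    (h : ∀ z ∈ s, z ∉ poles f) (j : Fin r) :
    ContinuousOn (fun z => (RatVec.eval f z ᵥ* γ.mat z) j) s := by
  simp only [Matrix.vecMul, dotProduct]
  exact continuousOn_finsetSum _ fun k _ =>
    (continuousOn_eval f h k).mul (γ.2 k j).continuous.continuousOn

theorem DiagQuad.notMem_poles_overDen (q : DiagQuad n r) (u : Fin r → ℂ[X]) {z : ℂ}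
    (hz : q.den.eval z ≠ 0) : z ∉ poles (q.overDen u) := by
  rintro ⟨j, hj⟩
  obtain ⟨e, he⟩ := RatFunc.denom_div_dvd (u j) q.den
  apply hz
  rw [he, eval_mul]
  exact mul_eq_zero_of_left hj _

theorem exists_norm_loop_le (γ : Loop r) (R : ℝ) :
    ∃ B : ℝ, 0 ≤ B ∧ ∀ z, ‖z‖ ≤ R → ∀ k j, ‖γ.mat z k j‖ ≤ B := by
  have h : ∀ k j : Fin r, ∃ B : ℝ, ∀ z ∈ Metric.closedBall (0 : ℂ) R, ‖γ.mat z k j‖ ≤ B :=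
    fun k j => (isCompact_closedBall 0 R).exists_bound_of_continuousOn
      (γ.2 k j).continuous.continuousOn
  choose B hB using h
  refine ⟨∑ k, ∑ j, |B k j|, by positivity, fun z hz k j => ?_⟩
  calc ‖γ.mat z k j‖ ≤ |B k j| := (hB k j z (by simpa using hz)).trans (le_abs_self _)
    _ ≤ ∑ j, |B k j| :=
      Finset.single_le_sum (f := fun j => |B k j|) (fun _ _ => abs_nonneg _) (Finset.mem_univ j)
    _ ≤ _ := Finset.single_le_sum (f := fun k => ∑ j, |B k j|)
      (fun _ _ => by positivity) (Finset.mem_univ k)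

theorem DiagQuad.exists_radius (q : DiagQuad n r) :
    ∀ᶠ R : ℝ in Filter.atTop, 0 < R ∧ ∀ i, ‖q.node i‖ < R :=
  (Filter.eventually_gt_atTop 0).and
    (Filter.eventually_all.2 fun _ => Filter.eventually_gt_atTop _)

theorem DiagQuad.loop_loop_inv (q : DiagQuad n r) (γ : Loop r) : (q.loop γ).loop γ⁻¹ = q := by
  rw [← DiagQuad.loop_mul, mul_inv_cancel, DiagQuad.loop_one]

theorem DiagQuad.prod_X_sub_C_eq (q : DiagQuad n r) :
    (((Finset.univ.val.map q.node + Finset.univ.val.map q.node).map fun a => X - C a).prod) =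
      q.den * q.den := by
  rw [Multiset.map_add, Multiset.prod_add, Multiset.map_map, DiagQuad.den, Lagrange.nodal_eq]
  rfl

/-- If `u γ⁻¹ = t + d² E` with `E` entire, then `t` has the jets of `u γ⁻¹` and so satisfies the
conditions of `q`. Replacing `E` by a polynomial `s` keeps these jets, and `(t + d² s) / d` is then
an approximant. -/
theorem DiagQuad.space_loop_le (q : DiagQuad n r) (γ : Loop r) :
    (q.loop γ).1.1.space ≤ loopAct q.1.1.space γ := by
  intro f hf
  obtain ⟨u, rfl, hu⟩ := ((q.loop γ).mem_space_iff f).1 hf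
  have hF : ∀ z j, HasDerivAt (fun t => (vecEval t u ᵥ* γ⁻¹.mat t) j) _ z :=
    fun z j => hasDerivAt_vecEval_vecMul u γ⁻¹ z j
  have := fun j => exists_eq_add_mul_entire
    (Finset.univ.val.map q.node + Finset.univ.val.map q.node) fun z => (hF z j).differentiableAt
  rw [q.prod_X_sub_C_eq] at this
  choose t E hE hFE using this
  have ht : ∀ i, q.JetCond i (vecEval (q.node i) t) (vecDeriv (q.node i) t) := by
    intro i
    have h := (hu i).loop γ⁻¹
    rw [q.loop_loop_inv] at h
    convert h using 1
    · ext j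
      refine Eq.trans ?_ (hFE j (q.node i)).symm
      simp [q.eval_den_node, vecEval]
    · ext j
      refine HasDerivAt.unique ?_ (hF (q.node i) j)
      simp only [hFE j]
      have h1 := ((t j).hasDerivAt (q.node i)).fun_add
        (((q.den * q.den).hasDerivAt (q.node i)).fun_mul (hE j (q.node i)).hasDerivAt)
      simpa [q.eval_den_node, vecDeriv] using h1
  change ∀ᶠ R : ℝ in Filter.atTop, _
  filter_upwards [q.exists_radius] with R ⟨hR, hnode⟩ ε hε
  obtain ⟨η, hη, hbound⟩ := exists_circleNorm_lt r hR hε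
  obtain ⟨B, hB0, hB⟩ := exists_norm_loop_le γ R
  obtain ⟨M, hM⟩ := (isCompact_closedBall (0 : ℂ) R).exists_bound_of_continuousOn
    q.den.continuous.continuousOn
  -- The error is a sum of `r` terms, each at most `|M| δ B`. The summand 1 keeps the denominator
  -- positive.
  have hδ : 0 < η / (r * |M| * B + 1) := by positivity
  choose s hs using fun j => exists_polynomial_near (hE j) R hδ
  refine ⟨q.overDen fun j => t j + q.den * q.den * s j, ?_, hbound _ fun z hz j => ?_⟩
  · rw [q.overDen_mem_space_iff]
    intro i
    have h1 : vecEval (q.node i) (fun j => t j + q.den * q.den * s j) = vecEval (q.node i) t := by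
      ext j; simp [vecEval, q.eval_den_node]
    have h2 : vecDeriv (q.node i) (fun j => t j + q.den * q.den * s j) =
        vecDeriv (q.node i) t := by
      ext j; simp [vecDeriv, q.eval_den_node]
    rw [h1, h2]
    exact ht i
  · have hden := q.eval_den_ne_zero_of_norm_eq hnode hz
    have hden' : (q.loop γ).den = q.den := rfl
    have hu' : vecEval z u = (vecEval z u ᵥ* γ⁻¹.mat z) ᵥ* γ.mat z := by
      rw [Matrix.vecMul_vecMul, Loop.mat_inv_mul, Matrix.vecMul_one]
    -- Since `u = (u γ⁻¹) γ`, the remainder `t` cancels and the error is `d (E - s) γ`, which is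
    -- small on the circle.
    have e : RatVec.eval ((q.loop γ).overDen u) z -
        RatVec.eval (q.overDen fun j => t j + q.den * q.den * s j) z ᵥ* γ.mat z =
        (fun j => q.den.eval z * (E j z - (s j).eval z)) ᵥ* γ.mat z := by
      rw [q.eval_overDen _ hden, (q.loop γ).eval_overDen _ (by rwa [hden']), hden', hu',
        ← Matrix.smul_vecMul, ← Matrix.sub_vecMul]
      congr 1
      ext j
      simp only [Pi.sub_apply, Pi.smul_apply, smul_eq_mul, hFE j z, vecEval, eval_add, eval_mul]
      field_simp
      ring
    rw [e]
    simp only [Matrix.vecMul, dotProduct]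
    calc ‖∑ k, q.den.eval z * (E k z - (s k).eval z) * γ.mat z k j‖
        ≤ ∑ _k : Fin r, |M| * (η / (r * |M| * B + 1)) * B := by
          refine norm_sum_le_of_le _ fun k _ => ?_
          rw [norm_mul, norm_mul]
          gcongr
          · exact (hM z (by simp [hz])).trans (le_abs_self _)
          · exact hs k z hz.le
          · exact hB z hz.le k j
      _ = (r * |M| * B) / (r * |M| * B + 1) * η := by
          simp only [Finset.sum_const, Finset.card_univ, Fintype.card_fin, nsmul_eq_mul]
          ring
      _ ≤ 1 * η := by
          gcongr
          exact (div_le_one (by positivity)).2 (by linarith)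
      _ = η := one_mul _

/-- Functions in the closure of `{g γ : g ∈ W}` on a circle: integrals of `f` against continuous
functions are limits of the integrals of a sequence in `{g γ : g ∈ W}`. -/
theorem DiagQuad.exists_seq_tendsto_circleIntegral (q : DiagQuad n r) (γ : Loop r) {f : RatVec r}
    {R : ℝ} (hR : 0 < R) (hnode : ∀ i, ‖q.node i‖ < R) (hf : ∀ z, ‖z‖ = R → z ∉ poles f)
    (h : ∀ ε : ENNReal, 0 < ε → ∃ g ∈ q.1.1.space,
      circleNorm R (fun z => RatVec.eval f z - RatVec.eval g z ᵥ* γ.mat z) < ε) :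
    ∃ u : ℕ → Fin r → ℂ[X],
      (∀ k i, q.JetCond i (vecEval (q.node i) (u k)) (vecDeriv (q.node i) (u k))) ∧
      ∀ φ : ℂ → ℂ, ContinuousOn φ (Metric.sphere 0 R) → ∀ j, Filter.Tendsto
        (fun k => ∮ z in C(0, R), φ z * ((q.den.eval z)⁻¹ * (vecEval z (u k) ᵥ* γ.mat z) j))
        Filter.atTop (nhds (∮ z in C(0, R), φ z * RatVec.eval f z j)) := by
  have h' : ∀ k : ℕ, ∃ u : Fin r → ℂ[X],
      (∀ i, q.JetCond i (vecEval (q.node i) u) (vecDeriv (q.node i) u)) ∧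
      circleNorm R (fun z => RatVec.eval f z - RatVec.eval (q.overDen u) z ᵥ* γ.mat z) <
        ((k : ENNReal) + 1)⁻¹ := by
    intro k
    obtain ⟨g, hg, hgε⟩ := h (((k : ENNReal) + 1)⁻¹)
      (ENNReal.inv_pos.2 (ENNReal.add_ne_top.2 ⟨ENNReal.natCast_ne_top k, ENNReal.one_ne_top⟩))
    obtain ⟨u, rfl, hu⟩ := (q.mem_space_iff g).1 hg
    exact ⟨u, hu, hgε⟩
  choose u hu hlt using h'
  refine ⟨u, hu, fun φ hφ j => ?_⟩
  obtain ⟨M, hM⟩ := (isCompact_sphere (0 : ℂ) R).exists_bound_of_continuousOn hφ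
  have hM' : ∀ z, ‖z‖ = R → ‖φ z‖ ≤ M := fun z hz => hM z (by simpa using hz)
  have hden : ∀ z ∈ Metric.sphere (0 : ℂ) R, q.den.eval z ≠ 0 := fun z hz =>
    q.eval_den_ne_zero_of_norm_eq hnode (by simpa using hz)
  have hnorm : Filter.Tendsto (fun k => circleNorm R
      (fun z => RatVec.eval f z - RatVec.eval (q.overDen (u k)) z ᵥ* γ.mat z))
      Filter.atTop (nhds 0) := by
    refine tendsto_of_tendsto_of_tendsto_of_le_of_le tendsto_const_nhds
      ?_ (fun _ => zero_le) fun k => (hlt k).le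
    have := ENNReal.tendsto_inv_nat_nhds_zero.comp (Filter.tendsto_add_atTop_nat 1)
    refine this.congr fun k => ?_
    simp
  have hzero := ENNReal.Tendsto.const_mul (a := ENNReal.ofReal (R * M))
    (ENNReal.Tendsto.mul_const (b := (MeasureTheory.volume.restrict
      (Set.Ioc (0 : ℝ) (2 * Real.pi))) Set.univ ^
        (1 / (1 : ENNReal).toReal - 1 / (2 : ENNReal).toReal)) hnorm
      (Or.inr (ENNReal.rpow_ne_top_of_nonneg (by norm_num) (MeasureTheory.measure_ne_top _ _))))
    (Or.inr ENNReal.ofReal_ne_top)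
  rw [zero_mul, mul_zero] at hzero
  have hcont : ∀ k, ContinuousOn
      (fun z => (RatVec.eval (q.overDen (u k)) z ᵥ* γ.mat z) j) (Metric.sphere 0 R) := fun k =>
    continuousOn_eval_vecMul γ (fun z hz => q.notMem_poles_overDen _ (hden z hz)) j
  have hfc : ContinuousOn (fun z => RatVec.eval f z j) (Metric.sphere 0 R) :=
    continuousOn_eval f (fun z hz => hf z (by simpa using hz)) j
  rw [tendsto_iff_edist_tendsto_0]
  refine tendsto_of_tendsto_of_tendsto_of_le_of_le tendsto_const_nhds hzero
    (fun _ => zero_le) fun k => ?_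
  refine le_trans (le_of_eq ?_) (enorm_circleIntegral_le hR hM'
    ((measurable_eval f).sub (measurable_eval_loop (q.overDen (u k)) γ)) j)
  rw [edist_comm, edist_eq_enorm_sub,
    ← circleIntegral.integral_sub (f := fun z => φ z * RatVec.eval f z j)
    ((hφ.mul hfc).circleIntegrable hR.le)]
  · refine congrArg _ (circleIntegral.integral_congr hR.le fun z hz => ?_)
    simp only [Pi.sub_apply]
    rw [q.eval_overDen _ (hden z hz), Matrix.smul_vecMul, Pi.smul_apply, smul_eq_mul, mul_sub]
  · refine ((hφ.mul (hcont k)).congr fun z hz => ?_).circleIntegrable hR.le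
    simp only [Pi.mul_apply]
    rw [q.eval_overDen _ (hden z hz), Matrix.smul_vecMul, Pi.smul_apply, smul_eq_mul]

/-- A rational function with all poles inside a circle, whose integrals against polynomials vanish,
has no poles. -/
theorem denom_eval_ne_zero_of_circleIntegral {h : RatFunc ℂ} {R : ℝ}
    (hpole : ∀ a, h.denom.eval a = 0 → ‖a‖ < R)
    (hint : ∀ p : ℂ[X], (∮ z in C(0, R), p.eval z * h.eval (RingHom.id ℂ) z) = 0) (a : ℂ) :
    h.denom.eval a ≠ 0 := by
  intro ha
  have haR := hpole a ha
  have hR : 0 < R := (norm_nonneg a).trans_lt haR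
  obtain ⟨d, hd⟩ := dvd_iff_isRoot.2 ha
  -- With the denominator written as `(z - a) d`, the test polynomial `d` turns the integrand into
  -- `num / (z - a)`. Cauchy's formula gives `2πi num(a)`, so the numerator vanishes at `a` too,
  -- against coprimality.
  have e : (∮ z in C(0, R), d.eval z * h.eval (RingHom.id ℂ) z) =
      ∮ z in C(0, R), (z - a)⁻¹ • h.num.eval z := by
    refine circleIntegral.integral_congr hR.le fun z hz => ?_
    have hz' : h.denom.eval z ≠ 0 := fun h0 => (hpole z h0).ne (by simpa using hz)
    have hd' : d.eval z ≠ 0 := by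
      intro h0
      rw [hd, eval_mul, h0, mul_zero] at hz'
      exact hz' rfl
    simp only [RatFunc.eval, eval₂_id, smul_eq_mul]
    rw [hd, eval_mul, eval_sub, eval_X, eval_C] at hz' ⊢
    have hza := left_ne_zero_of_mul hz'
    field_simp
  rw [hint, (h.num.differentiable.diffContOnCl).circleIntegral_sub_inv_smul (by simpa using haR),
    smul_eq_mul, eq_comm] at e
  have h0 : h.num.eval a = 0 := (mul_eq_zero.1 e).resolve_left Complex.two_pi_I_ne_zero
  obtain ⟨s, t, hst⟩ := h.isCoprime_num_denom
  have := congrArg (Polynomial.eval a) hst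
  simp [h0, ha] at this

theorem circleIntegral_sub_inv_mul {F : ℂ → ℂ} (hF : Differentiable ℂ F) {R : ℝ} {a : ℂ}
    (ha : a ∈ Metric.ball (0 : ℂ) R) :
    (2 * Real.pi * Complex.I : ℂ)⁻¹ * (∮ z in C(0, R), (z - a)⁻¹ * F z) = F a := by
  have := (hF.diffContOnCl (s := Metric.ball (0 : ℂ) R)).circleIntegral_sub_inv_smul ha
  simp only [smul_eq_mul] at this
  rw [this, inv_mul_cancel_left₀ Complex.two_pi_I_ne_zero]

theorem circleIntegral_sub_sq_inv_mul {F : ℂ → ℂ} (hF : Differentiable ℂ F) {R : ℝ} {a : ℂ}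
    (ha : a ∈ Metric.ball (0 : ℂ) R) :
    (2 * Real.pi * Complex.I : ℂ)⁻¹ * (∮ z in C(0, R), ((z - a) ^ 2)⁻¹ * F z) = deriv F a := by
  have := Complex.two_pi_I_inv_smul_circleIntegral_sub_sq_inv_smul_of_differentiable isOpen_univ
    (Set.subset_univ _) hF.differentiableOn ha
  simpa only [smul_eq_mul] using this

theorem DiagQuad.continuous_jetDefect (q : DiagQuad n r) (i : Fin n) :
    Continuous fun p : (Fin r → ℂ) × (Fin r → ℂ) => q.jetDefect i p.1 p.2 := by
  simp only [DiagQuad.jetDefect, dotProduct]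
  fun_prop

/-- The jet condition is the zero set of the continuous map `DiagQuad.jetDefect`, hence closed. -/
theorem DiagQuad.JetCond.of_tendsto {q : DiagQuad n r} {i : Fin n} {x y : ℕ → Fin r → ℂ}
    {x₀ y₀ : Fin r → ℂ} (h : ∀ k, q.JetCond i (x k) (y k))
    (hx : ∀ j, Filter.Tendsto (fun k => x k j) Filter.atTop (nhds (x₀ j)))
    (hy : ∀ j, Filter.Tendsto (fun k => y k j) Filter.atTop (nhds (y₀ j))) :
    q.JetCond i x₀ y₀ := by
  simp only [DiagQuad.jetCond_iff] at h ⊢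
  have h1 := ((q.continuous_jetDefect i).tendsto (x₀, y₀)).comp
    ((tendsto_pi_nhds.2 hx).prodMk_nhds (tendsto_pi_nhds.2 hy))
  refine tendsto_nhds_unique h1 (tendsto_const_nhds.congr fun k => (h k).symm)

theorem DiagQuad.loopAct_le (q : DiagQuad n r) (γ : Loop r) :
    loopAct q.1.1.space γ ≤ (q.loop γ).1.1.space := by
  intro f hf
  have hpoles : ∀ᶠ R : ℝ in Filter.atTop, ∀ z ∈ poles f, ‖z‖ < R :=
    ((poles_finite f).eventually_all).2 fun z _ => Filter.eventually_gt_atTop _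
  -- A single circle that encloses all nodes and all poles of `f` is enough.
  obtain ⟨R, happ, ⟨hR, hnode⟩, hpole⟩ :=
    ((show ∀ᶠ R : ℝ in Filter.atTop, _ from hf).and (q.exists_radius.and hpoles)).exists
  have hfc : ∀ z, ‖z‖ = R → z ∉ poles f := fun z hz hp => (hpole z hp).ne hz
  obtain ⟨u, hu, hlim⟩ := q.exists_seq_tendsto_circleIntegral γ hR hnode hfc happ
  have hden : ∀ z ∈ Metric.sphere (0 : ℂ) R, q.den.eval z ≠ 0 := fun z hz =>
    q.eval_den_ne_zero_of_norm_eq hnode (by simpa using hz)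
  set H : ℕ → ℂ → Fin r → ℂ := fun k z => vecEval z (u k) ᵥ* γ.mat z with hH
  have hHd : ∀ k j, Differentiable ℂ fun z => H k z j := fun k j z =>
    (hasDerivAt_vecEval_vecMul (u k) γ z j).differentiableAt
  -- Absorbing `d` into the test function passes from the approximants `H k / d` of `f` to the
  -- entire approximants `H k` of `d f`.
  have hlim' : ∀ φ : ℂ → ℂ, ContinuousOn φ (Metric.sphere 0 R) → ∀ j, Filter.Tendsto
      (fun k => ∮ z in C(0, R), φ z * H k z j) Filter.atTop
      (nhds (∮ z in C(0, R), φ z * (q.den.eval z * RatVec.eval f z j))) := by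
    intro φ hφ j
    have := hlim (fun z => φ z * q.den.eval z) (hφ.mul q.den.continuous.continuousOn) j
    have e : (∮ z in C(0, R), φ z * (q.den.eval z * RatVec.eval f z j)) =
        ∮ z in C(0, R), φ z * q.den.eval z * RatVec.eval f z j :=
      circleIntegral.integral_congr hR.le fun z _ => (mul_assoc _ _ _).symm
    rw [e]
    refine this.congr fun k => circleIntegral.integral_congr hR.le fun z hz => ?_
    have := hden z hz
    simp only [hH]
    field_simp
  have hU : ∀ j, ∃ p : ℂ[X], algebraMap _ _ q.den * f j = algebraMap _ _ p := by
    intro j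
    have hdvd : (algebraMap _ _ q.den * f j).denom ∣ (f j).denom := by
      have := RatFunc.denom_mul_dvd (algebraMap _ (RatFunc ℂ) q.den) (f j)
      rwa [RatFunc.denom_algebraMap, one_mul] at this
    have hpole' : ∀ a, (algebraMap _ _ q.den * f j).denom.eval a = 0 → a ∈ poles f := by
      intro a ha
      obtain ⟨e, he⟩ := hdvd
      exact ⟨j, by rw [he, eval_mul, ha, zero_mul]⟩
    refine exists_eq_algebraMap (denom_eval_ne_zero_of_circleIntegral (R := R)
      (fun a ha => hpole a (hpole' a ha)) fun p => ?_)
    have h1 := hlim' (fun z => p.eval z) p.continuous.continuousOn j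
    -- By Cauchy's theorem the entire `H k` integrate to zero against polynomials. So does their
    -- limit `d f`, which therefore has no poles.
    have h2 : ∀ k, (∮ z in C(0, R), p.eval z * H k z j) = 0 := fun k => by
      have hd : Differentiable ℂ fun z => p.eval z * H k z j := p.differentiable.fun_mul (hHd k j)
      exact Complex.circleIntegral_eq_zero_of_differentiable_on_off_countable hR.le
        Set.countable_empty hd.continuous.continuousOn fun z _ => hd z
    simp only [h2] at h1
    refine Eq.trans ?_ (tendsto_nhds_unique h1 tendsto_const_nhds)
    refine circleIntegral.integral_congr hR.le fun z hz => ?_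
    have hz' := hfc z (by simpa using hz)
    simp only [RatVec.eval]
    rw [RatFunc.eval_mul, RatFunc.eval_algebraMap]
    · simp
    · simp
    · rw [eval₂_id]; exact fun h0 => hz' ⟨j, h0⟩
  choose U hU using hU
  have hfU : f = (q.loop γ).overDen U := by
    funext j
    change _ = algebraMap _ _ (U j) / algebraMap _ _ q.den
    rw [← hU, mul_div_cancel_left₀ _ q.algebraMap_den_ne_zero]
  have hlimU : ∀ φ : ℂ → ℂ, ContinuousOn φ (Metric.sphere 0 R) → ∀ j, Filter.Tendsto
      (fun k => ∮ z in C(0, R), φ z * H k z j) Filter.atTop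
      (nhds (∮ z in C(0, R), φ z * (U j).eval z)) := by
    intro φ hφ j
    convert hlim' φ hφ j using 2
    refine circleIntegral.integral_congr hR.le fun z hz => ?_
    have hz' := hden z hz
    have : RatVec.eval f z = (q.den.eval z)⁻¹ • vecEval z U := by
      rw [hfU, (q.loop γ).eval_overDen U hz']
      rfl
    simp only [this, Pi.smul_apply, smul_eq_mul, vecEval]
    field_simp
  refine ((q.loop γ).mem_space_iff f).2 ⟨U, hfU, fun i => ?_⟩
  have hne : ∀ z ∈ Metric.sphere (0 : ℂ) R, z - q.node i ≠ 0 := fun z hz h0 => by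
    rw [sub_eq_zero.1 h0] at hz
    exact (hnode i).ne (by simpa using hz)
  have hball : q.node i ∈ Metric.ball (0 : ℂ) R := by simpa using hnode i
  have hsub : ContinuousOn (fun z : ℂ => z - q.node i) (Metric.sphere 0 R) := by fun_prop
  have hjet : ∀ k, (q.loop γ).JetCond i (H k (q.node i)) (vecDeriv (q.node i) (u k) ᵥ*
      γ.mat (q.node i) + vecEval (q.node i) (u k) ᵥ* γ.der (q.node i)) :=
    fun k => (hu k i).loop γ
  change (q.loop γ).JetCond i (vecEval (q.node i) U) (vecDeriv (q.node i) U)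
  -- The test functions `(z - λᵢ)⁻¹` and `(z - λᵢ)⁻²` recover values and derivatives at `λᵢ` by
  -- Cauchy's formulas, so the jets of `H k` converge to the jet of `U`.
  refine DiagQuad.JetCond.of_tendsto hjet (fun j => ?_) fun j => ?_
  · have h1 := hlimU (fun z => (z - q.node i)⁻¹) (hsub.inv₀ hne) j
    have h2 := fun {F : ℂ → ℂ} (hF : Differentiable ℂ F) =>
      circleIntegral_sub_inv_mul hF hball
    have h3 := h1.const_mul (2 * Real.pi * Complex.I : ℂ)⁻¹
    simp only [h2 (hHd _ j), h2 (U j).differentiable] at h3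
    exact h3
  · have hsq : ContinuousOn (fun z : ℂ => ((z - q.node i) ^ 2)⁻¹) (Metric.sphere 0 R) :=
      ContinuousOn.inv₀ (by fun_prop) fun z hz => pow_ne_zero 2 (hne z hz)
    have h1 := hlimU _ hsq j
    have h2 := fun {F : ℂ → ℂ} (hF : Differentiable ℂ F) =>
      circleIntegral_sub_sq_inv_mul hF hball
    have h3 := h1.const_mul (2 * Real.pi * Complex.I : ℂ)⁻¹
    simp only [h2 (hHd _ j), h2 (U j).differentiable, Polynomial.deriv] at h3
    refine h3.congr fun k => ?_
    exact (hasDerivAt_vecEval_vecMul (u k) γ (q.node i) j).deriv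

theorem DiagQuad.space_loop_eq (q : DiagQuad n r) (γ : Loop r) :
    (q.loop γ).1.1.space = loopAct q.1.1.space γ :=
  le_antisymm (q.space_loop_le γ) (q.loopAct_le γ)

end

end VectorCM

theorem mainTheorem2 (n r : ℕ) (hn : 0 < n) (hr : 0 < r) :
    ∃ β : VectorCM.CMd n r → ↥(VectorCM.adelicGr r),
      (∀ q : VectorCM.DiagQuad n r,
        (β q.toCMd : Submodule ℂ (VectorCM.RatVec r)) = q.1.1.space) ∧
      (∀ c : VectorCM.CMd n r, (β c : Submodule ℂ (VectorCM.RatVec r)) ∈ VectorCM.ratGr r) ∧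
      (∀ (c : VectorCM.CMd n r) (γ : VectorCM.Loop r),
        (β (MulOpposite.op γ • c) : Submodule ℂ (VectorCM.RatVec r)) =
          VectorCM.loopAct (β c) γ) := by
  have h : ∀ q : VectorCM.DiagQuad n r, q.toCMd.rep.1.1.space = q.1.1.space := fun q =>
    VectorCM.DiagQuad.space_eq_of_toCMd_eq (VectorCM.CMd.rep_spec _)
  refine ⟨fun c => ⟨c.rep.1.1.space, c.rep.space_mem_adelicGr⟩, h,
    fun c => c.rep.space_mem_ratGr, fun c γ => ?_⟩
  -- By definition `c ∘ γ` is the class of `c.rep.loop γ`, whose chosen representative may differ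
  -- from it but has the same space.
  exact (h (c.rep.loop γ)).trans (c.rep.space_loop_eq γ)
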